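/- Let $\mathcal F$ be a finite signature with a subset $\mathcal F_{AC}$ of binary symbols, $\mathcal V$ a set of variables, $>$ a precedence (an irreflexive and transitive relation on $\mathcal F$), and $(w,w_0)$ a weight function: $w:\mathcal F\to\mathbb N$, $w_0>0$, and $w(c)\ge w_0$ for all constants $c$. Assume admissibility: every unary $f$ with $w(f)=0$ satisfies $f>g$ for all symbols $g\ne f$. Write $=_{AC}$ for the congruence generated by associativity and commutativity of the symbols in $\mathcal F_{AC}$, and $|t|_x$ for the number of occurrences of $x$ in $t$. Put $w(x)=w_0$ for variables, $w(f(t_1,\dots,t_n))=w(f)+\sum_i w(t_i)$, and $\mathrm{root}(x)=x$, $\mathrm{root}(f(t_1,\dots,t_n))=f$; a variable is not comparable with any symbol or other variable by $>$. *Extensions.* For a preorder $\succsim$ and a relation $\succ$: $(x_1,\dots,x_n)\succ^{lex}(y_1,\dots,y_n)$ if for some $0\le k<n$, $x_i\succsim y_i$ for all $i\le k$ and $x_{k+1}\succ y_{k+1}$. For finite multisets, $M\succsim^{mul}N$ if one can write $M=\{x_1,\dots,x_m\}$, $N=\{y_1,\dots,y_n\}$ such that for some $0\le k\le\min(m,n)$,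 $x_j\succsim y_j$ for $j\le k$ and for each $k<j\le n$ there is $k<i\le m$ with $x_i\succ y_j$; and $M\succ^{mul}N$ if this is possible with $k<m$. *Auxiliary relations.* - $s=_{w,root}t$ if $|s|_x=|t|_x$ for all $x$, $w(s)=w(t)$ and $\mathrm{root}(s)=\mathrm{root}(t)$. - $s>_{w,root}t$ if $|s|_x\ge|t|_x$ for all $x$ and either $w(s)>w(t)$, or $w(s)=w(t)$ and $\mathrm{root}(s)>\mathrm{root}(t)$. - $s\ge_{kv'}t$ if $|s|_x\ge|t|_x$ for all $x$ and either $w(s)>w(t)$, or $w(s)=w(t)$ and ($\mathrm{root}(s)\ge\mathrm{root}(t)$ or $t\in\mathcal V$), where $\ge$ is the reflexive closure of $>$. For $f\in\mathcal F_{AC}$ let $\nabla_f(t)$ be the multiset $\{t\}$ if $\mathrm{root}(t)\ne f$, and $\nabla_f(t_1)\uplus\nabla_f(t_2)$ if $t=f(t_1,t_2)$. For a multiset $T$ of terms let $T{\restriction}_{\mathcal V}$ be the multiset of its variables and $T{\restriction}_f^{\nless}$ the multiset of its non-variable terms $t$ with $\mathrm{root}(t)\nless f$. Write $S\mathrel{R}^fT$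 for $S{\restriction}_f^{\nless}\mathrel{R}^{mul}\bigl(T{\restriction}_f^{\nless}\uplus(T{\restriction}_{\mathcal V}-S{\restriction}_{\mathcal V})\bigr)$. *The orders.* $>_{KV}$ is defined inductively: $s>_{KV}t$ if $|s|_x\ge|t|_x$ for all $x\in\mathcal V$ and either $w(s)>w(t)$, or $w(s)=w(t)$ and one of the following holds: - (0) $s=f^k(t)$ for a unary $f$ and some $k>0$, and $t\in\mathcal V$; - (1) $s=f(s_1,\dots,s_n)$, $t=g(t_1,\dots,t_m)$ and $f>g$; - (2) $s=f(s_1,\dots,s_n)$, $t=f(t_1,\dots,t_n)$, $f\notin\mathcal F_{AC}$ and $(s_1,\dots,s_n)>_{KV}^{lex}(t_1,\dots,t_n)$; - (3) $s=f(s_1,s_2)$, $t=f(t_1,t_2)$, $f\in\mathcal F_{AC}$ and, with $S=\nabla_f(s)$, $T=\nabla_f(t)$: (a) $S>_{w,root}^fT$; or (b) $S=_{w,root}^fT$ and $|S|>|T|$; or (c) $S=_{w,root}^fT$, $|S|=|T|$ and $S>_{KV}^{mul}T$. The preorder in $>_{KV}^{lex}$ and $>_{KV}^{mul}$ is $=_{AC}$.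 In all of (3a)-(3c), the multiset comparison of $S{\restriction}_f^{\nless}$ uses the preorder $=_{w,root}$ together with the strict relation $>_{w,root}$. The order $>_{KV'}$ is defined by the same clauses with recursive calls to $>_{KV'}$ and with $=_{w,root}$ replaced by $\ge_{kv'}$ throughout (3a)-(3c). **Theorem.** 1. $>_{KV'}$ is an AC-compatible simplification order: it is irreflexive, transitive, closed under contexts and under substitutions, satisfies $f(t_1,\dots,t_n)>_{KV'}t_i$ for all $1\le i\le n$, and ${=_{AC}}\cdot{>_{KV'}}\cdot{=_{AC}}\subseteq{>_{KV'}}$. 2. ${>_{KV}}\subseteq{>_{KV'}}$. 3. Consequently $>_{KV}$ is sound for proving AC termination: if $\mathcal R$ is a set of rewrite rules with $\ell>_{KV}r$ for every $\ell\to r$ in $\mathcal R$, then there is no infinite sequence of steps of the relation ${=_{AC}}\cdot{\to_{\mathcal R}}\cdot{=_{AC}}$. 4. This holds although $>_{KV}$ is in general not closed under contexts: it is not whenever there are a variable, an AC symbol, and a unary symbol of weight $0$. -/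

import Mathlib

universe u v w

namespace ACKBO

/-! The function symbols of a signature are the function symbols of a first-order language `L`
(its relation symbols play no role), and terms over variables `V` are `L.Term V`. -/

/-- Function symbols of the signature, together with their arity. -/
abbrev FunSym (L : FirstOrder.Language.{u, v}) : Type u := Σ n, L.Functions n

section Terms

variable {L : FirstOrder.Language.{u, v}} {V : Type w}

/-- The root of a term: a variable or a function symbol. -/
def root : L.Term V → V ⊕ FunSym L
  | .var x => Sum.inl x
  | .func (l := n) f _ => Sum.inr ⟨n, f⟩

def IsVar (t : L.Term V) : Prop := ∃ x, t = .var x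

open Classical in
/-- `occ x t` is the number of occurrences of the variable `x` in `t`. -/
noncomputable def occ (x : V) : L.Term V → ℕ
  | .var y => if y = x then 1 else 0
  | .func _ ts => ∑ i, occ x (ts i)

/-- The variable condition: every variable occurs in `s` at least as often as in `t`. -/
def VarGe (s t : L.Term V) : Prop := ∀ x : V, occ x t ≤ occ x s

/-- The congruence generated by commutativity and associativity of the symbols in `AC`. -/
inductive ACEq (AC : Set (L.Functions 2)) : L.Term V → L.Term V → Prop
  | comm (f : L.Functions 2) (hf : f ∈ AC) (s t : L.Term V) :
      ACEq AC (.func f ![s, t]) (.func f ![t, s])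
  | assoc (f : L.Functions 2) (hf : f ∈ AC) (s t u : L.Term V) :
      ACEq AC (.func f ![.func f ![s, t], u]) (.func f ![s, (.func f ![t, u])])
  | refl (t : L.Term V) : ACEq AC t t
  | symm {s t : L.Term V} : ACEq AC s t → ACEq AC t s
  | trans {s t u : L.Term V} : ACEq AC s t → ACEq AC t u → ACEq AC s u
  | congr {n : ℕ} (f : L.Functions n) (ss ts : Fin n → L.Term V) :
      (∀ i, ACEq AC (ss i) (ts i)) → ACEq AC (.func f ss) (.func f ts)

/-- The rewrite relation of a set of rules: the closure of the rules under substitutions and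
contexts. -/
inductive Rewrites (R : Set (L.Term V × L.Term V)) : L.Term V → L.Term V → Prop
  | rule (l r : L.Term V) (h : (l, r) ∈ R) (σ : V → L.Term V) :
      Rewrites R (l.subst σ) (r.subst σ)
  | context {n : ℕ} (f : L.Functions n) (ts : Fin n → L.Term V) (i : Fin n) (s t : L.Term V) :
      Rewrites R s t →
      Rewrites R (.func f (Function.update ts i s)) (.func f (Function.update ts i t))

/-- `R` is AC terminating: there is no infinite sequence of rewrite steps modulo AC. -/
def ACTerminating (AC : Set (L.Functions 2)) (R : Set (L.Term V × L.Term V)) : Prop :=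
  WellFounded fun t s : L.Term V =>
    ∃ s' t', ACEq AC s s' ∧ Rewrites R s' t' ∧ ACEq AC t' t

def ClosedUnderContexts (R : L.Term V → L.Term V → Prop) : Prop :=
  ∀ (n : ℕ) (f : L.Functions n) (ts : Fin n → L.Term V) (i : Fin n) (s t : L.Term V),
    R s t → R (.func f (Function.update ts i s)) (.func f (Function.update ts i t))

def ClosedUnderSubstitutions (R : L.Term V → L.Term V → Prop) : Prop :=
  ∀ (σ : V → L.Term V) (s t : L.Term V), R s t → R (s.subst σ) (t.subst σ)

def SubtermProperty (R : L.Term V → L.Term V → Prop) : Prop :=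
  ∀ (n : ℕ) (f : L.Functions n) (ts : Fin n → L.Term V) (i : Fin n), R (.func f ts) (ts i)

structure IsACCompatibleSimplificationOrder (AC : Set (L.Functions 2))
    (R : L.Term V → L.Term V → Prop) : Prop where
  irrefl : ∀ s, ¬ R s s
  trans : ∀ s t u, R s t → R t u → R s u
  contexts : ClosedUnderContexts R
  substitutions : ClosedUnderSubstitutions R
  subterm : SubtermProperty R
  ac_compatible : ∀ s s' t' t, ACEq AC s s' → R s' t' → ACEq AC t' t → R s t

end Terms

section Extensions

variable {A : Type*}

/-- The strict lexicographic extension of `(ge, gt)` to tuples of the same length. -/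
def LexGt (ge gt : A → A → Prop) {n : ℕ} (x y : Fin n → A) : Prop :=
  ∃ k : Fin n, (∀ i < k, ge (x i) (y i)) ∧ gt (x k) (y k)

/-- The non-strict multiset extension of `(ge, gt)`: the elements of `M₁` and `N₁` are paired
one-to-one by `ge`, and each remaining element of `N` is below a remaining element of `M`. -/
def MulGe (ge gt : A → A → Prop) (M N : Multiset A) : Prop :=
  ∃ M₁ M₂ N₁ N₂ : Multiset A, M = M₁ + M₂ ∧ N = N₁ + N₂ ∧ Multiset.Rel ge M₁ N₁ ∧
    ∀ y ∈ N₂, ∃ x ∈ M₂, gt x y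

/-- The strict multiset extension of `(ge, gt)`: not every element of `M` is used in the
one-to-one pairing by `ge`. -/
def MulGt (ge gt : A → A → Prop) (M N : Multiset A) : Prop :=
  ∃ M₁ M₂ N₁ N₂ : Multiset A, M = M₁ + M₂ ∧ N = N₁ + N₂ ∧ Multiset.Rel ge M₁ N₁ ∧ M₂ ≠ 0 ∧
    ∀ y ∈ N₂, ∃ x ∈ M₂, gt x y

end Extensions

/-- A precedence: a proper order on the function symbols. -/
structure Precedence (L : FirstOrder.Language.{u, v}) where
  gt : FunSym L → FunSym L → Prop
  irrefl : ∀ f, ¬ gt f f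
  trans : ∀ f g h, gt f g → gt g h → gt f h

/-- A weight function `(w, w₀)`. -/
structure WeightFunction (L : FirstOrder.Language.{u, v}) where
  w : FunSym L → ℕ
  w₀ : ℕ
  w₀_pos : 0 < w₀
  w₀_le_const : ∀ c : L.Functions 0, w₀ ≤ w ⟨0, c⟩

def WeightFunction.Admissible {L : FirstOrder.Language.{u, v}} (W : WeightFunction L) (P : Precedence L) :
    Prop :=
  ∀ f : L.Functions 1, W.w ⟨1, f⟩ = 0 → ∀ g : FunSym L, g ≠ ⟨1, f⟩ → P.gt ⟨1, f⟩ g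

section Orders

variable {L : FirstOrder.Language.{u, v}} {V : Type w}

/-- The weight of a term. -/
def weight (W : WeightFunction L) : L.Term V → ℕ
  | .var _ => W.w₀
  | .func (l := n) f ts => W.w ⟨n, f⟩ + ∑ i, weight W (ts i)

open Classical in
/-- The top-flattening of a term with respect to a binary symbol `f`. -/
noncomputable def topFlat (f : L.Functions 2) : L.Term V → Multiset (L.Term V)
  | .func (l := 2) g ts =>
      if g = f then topFlat f (ts 0) + topFlat f (ts 1) else {.func g ts}
  | t => {t}

open Classical in
/-- The variables in a multiset of terms. -/
noncomputable def varPart (T : Multiset (L.Term V)) : Multiset (L.Term V) :=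
  T.filter IsVar

open Classical in
/-- The non-variable terms in a multiset whose root symbol is not smaller than `f`. -/
noncomputable def notLtPart (P : Precedence L) (f : FunSym L) (T : Multiset (L.Term V)) :
    Multiset (L.Term V) :=
  T.filter fun t => ∃ g : FunSym L, root t = Sum.inr g ∧ ¬ P.gt f g

open Classical in
/-- The right-hand multiset in the comparison of `S` and `T` with respect to `f`:
the terms of `T` whose root is not smaller than `f`, and the variables of `T` (with multiplicity)
that exceed those of `S`. -/
noncomputable def rhsPart (P : Precedence L) (f : FunSym L) (S T : Multiset (L.Term V)) :
    Multiset (L.Term V) :=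
  notLtPart P f T + (varPart T - varPart S)

/-- `s =_{w,root} t`. -/
def WRootEq (W : WeightFunction L) (s t : L.Term V) : Prop :=
  (∀ x : V, occ x s = occ x t) ∧ weight W s = weight W t ∧ root s = root t

/-- `root s > root t` in the precedence; variables are incomparable to everything. -/
def RootGt (P : Precedence L) (s t : L.Term V) : Prop :=
  ∃ f g : FunSym L, root s = Sum.inr f ∧ root t = Sum.inr g ∧ P.gt f g

/-- `s >_{w,root} t`. -/
def WRootGt (P : Precedence L) (W : WeightFunction L) (s t : L.Term V) : Prop :=
  VarGe s t ∧ (weight W t < weight W s ∨ (weight W s = weight W t ∧ RootGt P s t))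

/-- `s ≥_{kv'} t`. -/
def KvGe (P : Precedence L) (W : WeightFunction L) (s t : L.Term V) : Prop :=
  VarGe s t ∧ (weight W t < weight W s ∨
    (weight W s = weight W t ∧ ((RootGt P s t ∨ root s = root t) ∨ IsVar t)))

/-- The alternatives for two terms of equal weight, with a relation `R` in place of recursive
calls. The relation `ge` is the preorder that accompanies `>_{w,root}` in the comparison of
top-flattenings. -/
inductive Alternative (AC : Set (L.Functions 2)) (P : Precedence L) (W : WeightFunction L)
    (ge R : L.Term V → L.Term V → Prop) : L.Term V → L.Term V → Prop
  | case0 (f : L.Functions 1) (x : V) (k : ℕ) (hk : 0 < k) :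
      Alternative AC P W ge R ((fun u : L.Term V => .func f ![u])^[k] (.var x)) (.var x)
  | case1 {n m : ℕ} (f : L.Functions n) (g : L.Functions m) (ss : Fin n → L.Term V)
      (ts : Fin m → L.Term V) (hfg : P.gt ⟨n, f⟩ ⟨m, g⟩) :
      Alternative AC P W ge R (.func f ss) (.func g ts)
  | case2 {n : ℕ} (f : L.Functions n) (ss ts : Fin n → L.Term V)
      (hf : ∀ h ∈ AC, (⟨n, f⟩ : FunSym L) ≠ ⟨2, h⟩) (hlex : LexGt (ACEq AC) R ss ts) :
      Alternative AC P W ge R (.func f ss) (.func f ts)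
  | case3a (f : L.Functions 2) (hf : f ∈ AC) (ss ts : Fin 2 → L.Term V)
      (h : MulGt ge (WRootGt P W) (notLtPart P ⟨2, f⟩ (topFlat f (.func f ss)))
        (rhsPart P ⟨2, f⟩ (topFlat f (.func f ss)) (topFlat f (.func f ts)))) :
      Alternative AC P W ge R (.func f ss) (.func f ts)
  | case3b (f : L.Functions 2) (hf : f ∈ AC) (ss ts : Fin 2 → L.Term V)
      (h : MulGe ge (WRootGt P W) (notLtPart P ⟨2, f⟩ (topFlat f (.func f ss)))
        (rhsPart P ⟨2, f⟩ (topFlat f (.func f ss)) (topFlat f (.func f ts))))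
      (hcard : (topFlat f (.func f ts)).card < (topFlat f (.func f ss)).card) :
      Alternative AC P W ge R (.func f ss) (.func f ts)
  | case3c (f : L.Functions 2) (hf : f ∈ AC) (ss ts : Fin 2 → L.Term V)
      (h : MulGe ge (WRootGt P W) (notLtPart P ⟨2, f⟩ (topFlat f (.func f ss)))
        (rhsPart P ⟨2, f⟩ (topFlat f (.func f ss)) (topFlat f (.func f ts))))
      (hcard : (topFlat f (.func f ss)).card = (topFlat f (.func f ts)).card)
      (hmul : MulGt (ACEq AC) R (topFlat f (.func f ss)) (topFlat f (.func f ts))) :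
      Alternative AC P W ge R (.func f ss) (.func f ts)

/-- One unfolding of the definition of the orders, with `R` in place of recursive calls. -/
def Step (AC : Set (L.Functions 2)) (P : Precedence L) (W : WeightFunction L)
    (ge R : L.Term V → L.Term V → Prop) (s t : L.Term V) : Prop :=
  VarGe s t ∧ (weight W t < weight W s ∨ (weight W s = weight W t ∧ Alternative AC P W ge R s t))

/-- The relation inductively defined by the clauses of `Step`, that is, the least relation that
is closed under `Step`; `kvScheme_iff` below is the recursive characterization. The auxiliary
relation `R` only serves to make the recursive occurrence strictly positive. -/
inductive KVScheme (AC : Set (L.Functions 2)) (P : Precedence L) (W : WeightFunction L)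
    (ge : L.Term V → L.Term V → Prop) : L.Term V → L.Term V → Prop
  | intro (R : L.Term V → L.Term V → Prop) (hR : ∀ s t, R s t → KVScheme AC P W ge s t)
      (s t : L.Term V) (h : Step AC P W ge R s t) : KVScheme AC P W ge s t

/-- The order `>_KV`: top-flattenings are compared with `=_{w,root}` and `>_{w,root}`. -/
def KV (AC : Set (L.Functions 2)) (P : Precedence L) (W : WeightFunction L) :
    L.Term V → L.Term V → Prop :=
  KVScheme AC P W (WRootEq W)

/-- The order `>_KV'`: top-flattenings are compared with `≥_{kv'}` and `>_{w,root}`. -/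
def KV' (AC : Set (L.Functions 2)) (P : Precedence L) (W : WeightFunction L) :
    L.Term V → L.Term V → Prop :=
  KVScheme AC P W (KvGe P W)

theorem MulGt.mono {A : Type*} {ge R R' : A → A → Prop} (h : ∀ a b, R a b → R' a b)
    {M N : Multiset A} (hM : MulGt ge R M N) : MulGt ge R' M N := by
  obtain ⟨M₁, M₂, N₁, N₂, h1, h2, h3, h4, h5⟩ := hM
  refine ⟨M₁, M₂, N₁, N₂, h1, h2, h3, h4, fun y hy => ?_⟩
  obtain ⟨x, hx, hxy⟩ := h5 y hy
  exact ⟨x, hx, h _ _ hxy⟩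

theorem Step.mono {AC : Set (L.Functions 2)} {P : Precedence L} {W : WeightFunction L}
    {ge R R' : L.Term V → L.Term V → Prop} (hRR' : ∀ s t, R s t → R' s t) {s t : L.Term V}
    (h : Step AC P W ge R s t) : Step AC P W ge R' s t := by
  refine ⟨h.1, h.2.imp id fun h2 => ⟨h2.1, ?_⟩⟩
  cases h2.2 with
  | case0 f x k hk => exact .case0 f x k hk
  | case1 f g ss ts hfg => exact .case1 f g ss ts hfg
  | case2 f ss ts hf hlex =>
    obtain ⟨k, h1, h2⟩ := hlex
    exact .case2 f ss ts hf ⟨k, h1, hRR' _ _ h2⟩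
  | case3a f hf ss ts h3 => exact .case3a f hf ss ts h3
  | case3b f hf ss ts h3 hcard => exact .case3b f hf ss ts h3 hcard
  | case3c f hf ss ts h3 hcard hmul => exact .case3c f hf ss ts h3 hcard (hmul.mono hRR')

theorem kvScheme_iff {AC : Set (L.Functions 2)} {P : Precedence L} {W : WeightFunction L}
    {ge : L.Term V → L.Term V → Prop} (s t : L.Term V) :
    KVScheme AC P W ge s t ↔ Step AC P W ge (KVScheme AC P W ge) s t := by
  constructor
  · rintro ⟨R, hR, _, _, h⟩
    exact h.mono hR
  · exact fun h => .intro _ (fun _ _ h => h) s t h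

end Orders

end ACKBO

open ACKBO

/-!
Let `s >_KV' t` be the order in which top-flattenings are compared by `≥_{kv'}` and `>_{w,root}`.

The main structural fact is that these two relations form an order pair (`orderPair_kvGe`). This
uses admissibility: a non-variable term with the weight of a variable that occurs in it is a tower
`f(f(…f(x)…))` over the unique unary symbol `f` of weight zero, whose root is maximal
(`exists_iterate_of_weight_eq`). Hence multiset comparisons compose (`mulExt_comp`), the comparison
`≥^f` of top-flattenings is transitive even though its right-hand side depends on its left-hand
side (`FlatGe.trans`), and transitivity and AC-compatibility of `>_KV'` follow by induction on
derivations (`KV'.trans`, `KV'.comp_aCEq`, `KV'.aCEq_comp`). For the latter, AC-equal terms have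
elementwise AC-equal top-flattenings.

Closure under contexts rests on `KV'.flatStep`: a decrease at equal weight survives below an AC
symbol `f`, because it is visible in the top-flattenings with respect to `f`, and comparisons of
top-flattenings are preserved when the same terms are added on both sides.

For closure under substitutions the critical terms are the variables `y` that occur more often in
the right top-flattening and whose instances have root `f`, so that they are flattened further. The
term that dominates `y` then strictly dominates every piece by weight, so the comparison becomes
strict (`FlatGe.subst`). If there is no such variable, then the left top-flattening grows at least
as much as the right one.

As `ℕ` and the precedence on a finite signature are well-founded, `>_KV'` is well-founded: a term
with accessible arguments is accessible, by lexicographic induction on its weight, its root, and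
either the ranks of its arguments or the multisets of ranks of its top-flattening in the
Dershowitz–Manna order (`acc_of_argsAcc`). Well-foundedness also gives irreflexivity. Since `>_KV`
is contained in `>_KV'`, rewriting modulo AC with rules oriented by `>_KV` is contained in `>_KV'`,
hence terminates. On the other hand `f(x) >_KV x` but not `h(f(x), x) >_KV h(x, x)` for an AC
symbol `h` and a unary symbol `f` of weight zero (`not_closedUnderContexts_kv`).
-/

namespace ACKBO

/-! ### Extensions of pairs of relations to tuples and multisets -/

section Extensions

open Multiset

variable {A : Type*}

theorem LexGt.comp {ge gt₁ gt₂ gt₃ : A → A → Prop}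
    (hge : ∀ a b c, ge a b → ge b c → ge a c) (h₁ : ∀ a b c, gt₁ a b → ge b c → gt₃ a c)
    (h₂ : ∀ a b c, ge a b → gt₂ b c → gt₃ a c) (h₁₂ : ∀ a b c, gt₁ a b → gt₂ b c → gt₃ a c)
    {n : ℕ} {x y z : Fin n → A} (hxy : LexGt ge gt₁ x y) (hyz : LexGt ge gt₂ y z) :
    LexGt ge gt₃ x z := by
  obtain ⟨k, hk, hk'⟩ := hxy
  obtain ⟨l, hl, hl'⟩ := hyz
  rcases lt_trichotomy k l with h | rfl | h
  · exact ⟨k, fun i hi => hge _ _ _ (hk i hi) (hl i (hi.trans h)), h₁ _ _ _ hk' (hl k h)⟩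
  · exact ⟨k, fun i hi => hge _ _ _ (hk i hi) (hl i hi), h₁₂ _ _ _ hk' hl'⟩
  · exact ⟨l, fun i hi => hge _ _ _ (hk i (hi.trans h)) (hl i hi), h₂ _ _ _ (hk l h) hl'⟩

/-- Two decompositions of a multiset have a common refinement. -/
theorem exists_refinement {M₁ M₂ N₁ N₂ : Multiset A} (h : M₁ + M₂ = N₁ + N₂) :
    ∃ a b c d, M₁ = a + b ∧ M₂ = c + d ∧ N₁ = a + c ∧ N₂ = b + d := by
  classical
  have hc : ∀ x, M₁.count x + M₂.count x = N₁.count x + N₂.count x := fun x => by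
    rw [← count_add, h, count_add]
  refine ⟨M₁ ∩ N₁, M₁ - N₁, N₁ - M₁, M₂ - (N₁ - M₁), ?_, ?_, ?_, ?_⟩ <;> ext x <;>
    have := hc x <;> simp only [count_add, count_inter, count_sub] <;> omega

theorem rel_comp {r p q : A → A → Prop} (h : ∀ a b c, r a b → p b c → q a c)
    {M N K : Multiset A} (hMN : Rel r M N) (hNK : Rel p N K) : Rel q M K := by
  induction hMN generalizing K with
  | zero => rw [rel_zero_left.mp hNK]; exact .zero
  | cons hab _ ih =>
    obtain ⟨c, K', hbc, hK', rfl⟩ := rel_cons_left.mp hNK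
    exact .cons (h _ _ _ hab hbc) (ih hK')

/-- Composition of two comparisons of multisets. The middle multiset `N₁ + N₂ = N₁' + N₂'` is cut
into the four pieces given by its two decompositions. -/
theorem mulExt_comp {ge gt₁ gt₂ gt₃ : A → A → Prop}
    (hge : ∀ a b c, ge a b → ge b c → ge a c) (h₁ : ∀ a b c, gt₁ a b → ge b c → gt₃ a c)
    (h₂ : ∀ a b c, ge a b → gt₂ b c → gt₃ a c) (h₁₂ : ∀ a b c, gt₁ a b → gt₂ b c → gt₃ a c)
    {M₁ M₂ N₁ N₂ N₁' N₂' K₁ K₂ : Multiset A} (hN : N₁ + N₂ = N₁' + N₂')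
    (hMN : Rel ge M₁ N₁) (hMN' : ∀ y ∈ N₂, ∃ x ∈ M₂, gt₁ x y)
    (hNK : Rel ge N₁' K₁) (hNK' : ∀ y ∈ K₂, ∃ x ∈ N₂', gt₂ x y) :
    ∃ M₁' M₂' K₁' K₂', M₁ + M₂ = M₁' + M₂' ∧ K₁ + K₂ = K₁' + K₂' ∧ Rel ge M₁' K₁' ∧
      (M₂ ≠ 0 ∨ N₂' ≠ 0 → M₂' ≠ 0) ∧ ∀ y ∈ K₂', ∃ x ∈ M₂', gt₃ x y := by
  obtain ⟨a, b, c, d, rfl, rfl, rfl, rfl⟩ := exists_refinement hN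
  obtain ⟨Ma, Mb, ha, hb, rfl⟩ := rel_add_right.mp hMN
  obtain ⟨Ka, Kc, ha', hc, rfl⟩ := rel_add_left.mp hNK
  refine ⟨Ma, Mb + M₂, Ka, Kc + K₂, by rw [add_assoc], by rw [add_assoc],
    rel_comp hge ha ha', ?_, ?_⟩
  · rintro (h | h) h0
    · exact h (add_eq_zero.mp h0).2
    · obtain ⟨rfl, rfl⟩ := add_eq_zero.mp h0
      rw [rel_zero_left.mp hb, zero_add] at h
      obtain ⟨y, hy⟩ := exists_mem_of_ne_zero h
      obtain ⟨x, hx, -⟩ := hMN' y (mem_add.mpr (.inr hy))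
      exact notMem_zero x hx
  · intro z hz
    rcases mem_add.mp hz with hz | hz
    · obtain ⟨y, hy, hyz⟩ := exists_mem_of_rel_of_mem (rel_flip.mpr hc) hz
      obtain ⟨x, hx, hxy⟩ := hMN' y (mem_add.mpr (.inl hy))
      exact ⟨x, mem_add.mpr (.inr hx), h₁ _ _ _ hxy hyz⟩
    · obtain ⟨y, hy, hyz⟩ := hNK' z hz
      rcases mem_add.mp hy with hy | hy
      · obtain ⟨x, hx, hxy⟩ := exists_mem_of_rel_of_mem (rel_flip.mpr hb) hy
        exact ⟨x, mem_add.mpr (.inl hx), h₂ _ _ _ hxy hyz⟩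
      · obtain ⟨x, hx, hxy⟩ := hMN' y (mem_add.mpr (.inr hy))
        exact ⟨x, mem_add.mpr (.inr hx), h₁₂ _ _ _ hxy hyz⟩

theorem MulGt.comp {ge gt₁ gt₂ gt₃ : A → A → Prop}
    (hge : ∀ a b c, ge a b → ge b c → ge a c) (h₁ : ∀ a b c, gt₁ a b → ge b c → gt₃ a c)
    (h₂ : ∀ a b c, ge a b → gt₂ b c → gt₃ a c) (h₁₂ : ∀ a b c, gt₁ a b → gt₂ b c → gt₃ a c)
    {M N K : Multiset A} (hMN : MulGt ge gt₁ M N) (hNK : MulGt ge gt₂ N K) :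
    MulGt ge gt₃ M K := by
  obtain ⟨M₁, M₂, N₁, N₂, rfl, rfl, hr, h0, hd⟩ := hMN
  obtain ⟨N₁', N₂', K₁, K₂, hN, rfl, hr', -, hd'⟩ := hNK
  obtain ⟨a, b, c, d, e₁, e₂, e₃, e₄, e₅⟩ := mulExt_comp hge h₁ h₂ h₁₂ hN hr hd hr' hd'
  exact ⟨a, b, c, d, e₁, e₂, e₃, e₄ (.inl h0), e₅⟩

theorem MulGt.rel_comp {ge gt₁ gt₃ : A → A → Prop}
    (hge : ∀ a b c, ge a b → ge b c → ge a c) (h₁ : ∀ a b c, gt₁ a b → ge b c → gt₃ a c)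
    {M N K : Multiset A} (hMN : MulGt ge gt₁ M N) (hNK : Rel ge N K) : MulGt ge gt₃ M K := by
  obtain ⟨M₁, M₂, N₁, N₂, rfl, rfl, hr, h0, hd⟩ := hMN
  obtain ⟨a, b, c, d, e₁, e₂, e₃, e₄, e₅⟩ :=
    mulExt_comp (gt₂ := fun _ _ => False) (gt₃ := gt₃) (N₂' := 0) (K₂ := 0) hge h₁
      (fun _ _ _ _ h => h.elim) (fun _ _ _ _ h => h.elim) (add_zero _).symm hr hd hNK (by simp)
  exact ⟨a, b, c, d, e₁, by rw [← e₂, add_zero], e₃, e₄ (.inl h0), e₅⟩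

theorem MulGt.comp_rel {ge gt₂ gt₃ : A → A → Prop}
    (hge : ∀ a b c, ge a b → ge b c → ge a c) (h₂ : ∀ a b c, ge a b → gt₂ b c → gt₃ a c)
    {M N K : Multiset A} (hMN : Rel ge M N) (hNK : MulGt ge gt₂ N K) : MulGt ge gt₃ M K := by
  obtain ⟨N₁', N₂', K₁, K₂, rfl, rfl, hr', h0, hd'⟩ := hNK
  obtain ⟨a, b, c, d, e₁, e₂, e₃, e₄, e₅⟩ :=
    mulExt_comp (gt₁ := fun _ _ => False) (gt₃ := gt₃) (M₂ := 0) (N₂ := 0) hge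
      (fun _ _ _ h => h.elim) h₂ (fun _ _ _ h => h.elim) (add_zero _) hMN (by simp) hr' hd'
  exact ⟨a, b, c, d, by rw [← e₁, add_zero], e₂, e₃, e₄ (.inr h0), e₅⟩

section

variable {ge gt : A → A → Prop} {M M' N N' K : Multiset A}

theorem MulGt.mulGe (h : MulGt ge gt M N) : MulGe ge gt M N := by
  obtain ⟨M₁, M₂, N₁, N₂, h1, h2, h3, -, h5⟩ := h
  exact ⟨M₁, M₂, N₁, N₂, h1, h2, h3, h5⟩

theorem MulGe.of_rel (h : Rel ge M N) : MulGe ge gt M N :=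
  ⟨M, 0, N, 0, by simp, by simp, h, by simp⟩

theorem MulGe.zero_right : MulGe ge gt M 0 := ⟨0, M, 0, 0, by simp, by simp, .zero, by simp⟩

theorem MulGt.of_forall (hM : M ≠ 0) (h : ∀ y ∈ N, ∃ x ∈ M, gt x y) : MulGt ge gt M N :=
  ⟨0, M, 0, N, by simp, by simp, .zero, hM, h⟩

theorem MulGe.add (h : MulGe ge gt M N) (h' : MulGe ge gt M' N') :
    MulGe ge gt (M + M') (N + N') := by
  obtain ⟨M₁, M₂, N₁, N₂, rfl, rfl, h3, h5⟩ := h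
  obtain ⟨M₁', M₂', N₁', N₂', rfl, rfl, h3', h5'⟩ := h'
  refine ⟨M₁ + M₁', M₂ + M₂', N₁ + N₁', N₂ + N₂', add_add_add_comm .., add_add_add_comm ..,
    h3.add h3', fun y hy => ?_⟩
  rcases mem_add.mp hy with hy | hy
  · exact (h5 y hy).imp fun x hx => ⟨mem_add.mpr (.inl hx.1), hx.2⟩
  · exact (h5' y hy).imp fun x hx => ⟨mem_add.mpr (.inr hx.1), hx.2⟩

theorem MulGt.add_mulGe (h : MulGt ge gt M N) (h' : MulGe ge gt M' N') :
    MulGt ge gt (M + M') (N + N') := by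
  obtain ⟨M₁, M₂, N₁, N₂, rfl, rfl, h3, h4, h5⟩ := h
  obtain ⟨M₁', M₂', N₁', N₂', rfl, rfl, h3', h5'⟩ := h'
  refine ⟨M₁ + M₁', M₂ + M₂', N₁ + N₁', N₂ + N₂', add_add_add_comm .., add_add_add_comm ..,
    h3.add h3', fun h0 => h4 (add_eq_zero.mp h0).1, fun y hy => ?_⟩
  rcases mem_add.mp hy with hy | hy
  · exact (h5 y hy).imp fun x hx => ⟨mem_add.mpr (.inl hx.1), hx.2⟩
  · exact (h5' y hy).imp fun x hx => ⟨mem_add.mpr (.inr hx.1), hx.2⟩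

end

/-- A preorder `ge` together with a transitive relation `gt` that absorbs it on both sides. -/
structure OrderPair (ge gt : A → A → Prop) : Prop where
  refl : ∀ a, ge a a
  ge_ge : ∀ a b c, ge a b → ge b c → ge a c
  gt_ge : ∀ a b c, gt a b → ge b c → gt a c
  ge_gt : ∀ a b c, ge a b → gt b c → gt a c
  gt_gt : ∀ a b c, gt a b → gt b c → gt a c

namespace OrderPair

variable {ge gt : A → A → Prop} {M N K : Multiset A}

theorem mulGe_refl (hp : OrderPair ge gt) (M : Multiset A) : MulGe ge gt M M :=
  .of_rel (rel_refl_of_refl_on fun x _ => hp.refl x)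

theorem mulGe_trans (hp : OrderPair ge gt) (hMN : MulGe ge gt M N) (hNK : MulGe ge gt N K) :
    MulGe ge gt M K := by
  obtain ⟨M₁, M₂, N₁, N₂, rfl, rfl, hr, hd⟩ := hMN
  obtain ⟨N₁', N₂', K₁, K₂, hN, rfl, hr', hd'⟩ := hNK
  obtain ⟨a, b, c, d, e₁, e₂, e₃, -, e₅⟩ :=
    mulExt_comp hp.ge_ge hp.gt_ge hp.ge_gt hp.gt_gt hN hr hd hr' hd'
  exact ⟨a, b, c, d, e₁, e₂, e₃, e₅⟩

theorem mulGt_mulGe_trans (hp : OrderPair ge gt) (hMN : MulGt ge gt M N)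
    (hNK : MulGe ge gt N K) : MulGt ge gt M K := by
  obtain ⟨M₁, M₂, N₁, N₂, rfl, rfl, hr, h0, hd⟩ := hMN
  obtain ⟨N₁', N₂', K₁, K₂, hN, rfl, hr', hd'⟩ := hNK
  obtain ⟨a, b, c, d, e₁, e₂, e₃, e₄, e₅⟩ :=
    mulExt_comp hp.ge_ge hp.gt_ge hp.ge_gt hp.gt_gt hN hr hd hr' hd'
  exact ⟨a, b, c, d, e₁, e₂, e₃, e₄ (.inl h0), e₅⟩

theorem mulGe_mulGt_trans (hp : OrderPair ge gt) (hMN : MulGe ge gt M N)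
    (hNK : MulGt ge gt N K) : MulGt ge gt M K := by
  obtain ⟨M₁, M₂, N₁, N₂, rfl, rfl, hr, hd⟩ := hMN
  obtain ⟨N₁', N₂', K₁, K₂, hN, rfl, hr', h0, hd'⟩ := hNK
  obtain ⟨a, b, c, d, e₁, e₂, e₃, e₄, e₅⟩ :=
    mulExt_comp hp.ge_ge hp.gt_ge hp.ge_gt hp.gt_gt hN hr hd hr' hd'
  exact ⟨a, b, c, d, e₁, e₂, e₃, e₄ (.inr h0), e₅⟩

theorem mulGe_of_le (hp : OrderPair ge gt) (h : N ≤ M) : MulGe ge gt M N := by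
  obtain ⟨K, rfl⟩ := Multiset.le_iff_exists_add.mp h
  simpa using (hp.mulGe_refl N).add (MulGe.zero_right (M := K))

end OrderPair

/-! ### Comparison of multiset extensions with the Dershowitz–Manna order -/

section DershowitzManna

variable {B : Type*} [PartialOrder B] {ge gt : A → A → Prop} {ρ : A → B} {M N : Multiset A}

/-- In terms of a rank function `ρ`, an elementwise comparison by `ge` splits into a common part
`X` and a part where the rank strictly decreases. -/
theorem exists_strict_part_of_rel (h : Rel ge M N) (hge : ∀ a b, ge a b → ρ b ≤ ρ a) :
    ∃ X Y Z : Multiset B, N.map ρ = X + Y ∧ M.map ρ = X + Z ∧ (Z = 0 → Y = 0) ∧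
      ∀ y ∈ Y, ∃ z ∈ Z, y < z := by
  induction h with
  | zero => exact ⟨0, 0, 0, by simp⟩
  | @cons a b _ _ hab _ ih =>
    obtain ⟨X, Y, Z, hY, hZ, h0, hlt⟩ := ih
    rcases (hge a b hab).eq_or_lt with h | h
    · exact ⟨ρ b ::ₘ X, Y, Z, by simp [hY], by simp [hZ, h], h0, hlt⟩
    · refine ⟨X, ρ b ::ₘ Y, ρ a ::ₘ Z, by simp [hY], by simp [hZ], by simp, ?_⟩
      simp only [mem_cons, forall_eq_or_imp, exists_eq_or_imp]
      exact ⟨.inl h, fun y hy => .inr (hlt y hy)⟩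

theorem MulGt.isDershowitzMannaLT (h : MulGt ge gt M N) (hge : ∀ a b, ge a b → ρ b ≤ ρ a)
    (hgt : ∀ a ∈ M, ∀ b, gt a b → ρ b < ρ a) : IsDershowitzMannaLT (N.map ρ) (M.map ρ) := by
  obtain ⟨M₁, M₂, N₁, N₂, rfl, rfl, hr, hM₂, hd⟩ := h
  obtain ⟨X, Y, Z, hY, hZ, -, hlt⟩ := exists_strict_part_of_rel hr hge
  refine ⟨X, Y + N₂.map ρ, Z + M₂.map ρ, by simp [hM₂], by simp [hY, add_assoc],
    by simp [hZ, add_assoc], fun y hy => ?_⟩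
  rcases mem_add.mp hy with hy | hy
  · exact (hlt y hy).imp fun z hz => ⟨mem_add.mpr (.inl hz.1), hz.2⟩
  · obtain ⟨b, hb, rfl⟩ := mem_map.mp hy
    obtain ⟨a, ha, hab⟩ := hd b hb
    exact ⟨ρ a, mem_add.mpr (.inr (mem_map_of_mem ρ ha)), hgt a (mem_add.mpr (.inr ha)) b hab⟩

theorem MulGe.eq_or_isDershowitzMannaLT (h : MulGe ge gt M N)
    (hge : ∀ a b, ge a b → ρ b ≤ ρ a) (hgt : ∀ a ∈ M, ∀ b, gt a b → ρ b < ρ a) :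
    N.map ρ = M.map ρ ∨ IsDershowitzMannaLT (N.map ρ) (M.map ρ) := by
  by_cases hM : MulGt ge gt M N
  · exact .inr (hM.isDershowitzMannaLT hge hgt)
  obtain ⟨M₁, M₂, N₁, N₂, rfl, rfl, hr, hd⟩ := h
  obtain rfl : M₂ = 0 := by
    by_contra h0
    exact hM ⟨M₁, M₂, N₁, N₂, rfl, rfl, hr, h0, hd⟩
  obtain rfl : N₂ = 0 := eq_zero_of_forall_notMem fun y hy => by simpa using hd y hy
  obtain ⟨X, Y, Z, hY, hZ, h0, hlt⟩ := exists_strict_part_of_rel hr hge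
  by_cases hZ0 : Z = 0
  · left; simp [hY, hZ, h0 hZ0, hZ0]
  · right; exact ⟨X, Y, Z, hZ0, by simpa using hY, by simpa using hZ, hlt⟩

end DershowitzManna

end Extensions

open FirstOrder.Language Multiset

/-! ### Weights, variable occurrences and roots -/

section Basic

variable {L : FirstOrder.Language.{u, v}} {V : Type w}

/-- The multiset of variable occurrences of a term. -/
def vars : L.Term V → Multiset V
  | .var x => {x}
  | .func _ ts => ∑ i, vars (ts i)

open Classical in
theorem count_vars (x : V) (t : L.Term V) : (vars t).count x = occ x t := by
  induction t with
  | var y => simp [vars, occ, count_singleton, eq_comm]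
  | func f ts ih => simp [vars, occ, count_sum', ih]

theorem varGe_iff_le {s t : L.Term V} : VarGe s t ↔ vars t ≤ vars s := by
  classical
  simp [VarGe, le_iff_count, count_vars]

theorem VarGe.refl (s : L.Term V) : VarGe s s := fun _ => le_rfl

theorem VarGe.trans {s t u : L.Term V} (h : VarGe s t) (h' : VarGe t u) : VarGe s u :=
  fun x => (h' x).trans (h x)

theorem vars_subst {U : Type*} (σ : V → L.Term U) (t : L.Term V) :
    vars (t.subst σ) = (vars t).bind fun x => vars (σ x) := by
  induction t with
  | var y => simp [vars, Term.subst]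
  | func f ts ih =>
    simp only [vars, Term.subst, ih]
    exact (map_sum (⟨⟨fun m : Multiset V => m.bind fun x => vars (σ x), by simp⟩, by simp⟩ :
      Multiset V →+ Multiset U) (fun i => vars (ts i)) Finset.univ).symm

theorem VarGe.subst {s t : L.Term V} (h : VarGe s t) (σ : V → L.Term V) :
    VarGe (s.subst σ) (t.subst σ) := by
  obtain ⟨K, hK⟩ := Multiset.le_iff_exists_add.mp (varGe_iff_le.mp h)
  rw [varGe_iff_le, vars_subst, vars_subst, hK, add_bind]
  exact Multiset.le_add_right _ _

theorem VarGe.func_of_forall {n : ℕ} (f : L.Functions n) {ss ts : Fin n → L.Term V}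
    (h : ∀ i, VarGe (ss i) (ts i)) : VarGe (.func f ss) (.func f ts) :=
  fun x => Finset.sum_le_sum fun i _ => h i x

theorem varGe_arg {n : ℕ} (f : L.Functions n) (ts : Fin n → L.Term V) (i : Fin n) :
    VarGe (.func f ts) (ts i) :=
  fun x => Finset.single_le_sum (f := fun i => occ x (ts i)) (fun _ _ => Nat.zero_le _)
    (Finset.mem_univ i)

theorem VarGe.one_le_occ {s : L.Term V} {x : V} (h : VarGe s (.var x)) : 1 ≤ occ x s := by
  simpa [occ] using h x

theorem isVar_iff_root {s : L.Term V} : IsVar s ↔ ∃ x, root s = Sum.inl x := by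
  cases s <;> simp [IsVar, root]

theorem not_isVar_func {n : ℕ} (f : L.Functions n) (ts : Fin n → L.Term V) :
    ¬ IsVar (.func f ts) := by
  simp [IsVar]

theorem not_isVar_of_root {s : L.Term V} {g : FunSym L} (h : root s = .inr g) : ¬ IsVar s := by
  simp [isVar_iff_root, h]

theorem exists_root_of_not_isVar {s : L.Term V} (h : ¬ IsVar s) : ∃ g, root s = .inr g := by
  cases s with
  | var x => exact (h ⟨x, rfl⟩).elim
  | func f ts => exact ⟨_, rfl⟩

theorem exists_func_of_root {s : L.Term V} {n : ℕ} {f : L.Functions n}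
    (h : root s = .inr ⟨n, f⟩) : ∃ ts, s = .func f ts := by
  cases s with
  | var x => simp [root] at h
  | func g ts => cases h; exact ⟨ts, rfl⟩

theorem exists_var_of_root {s : L.Term V} {x : V} (h : root s = .inl x) : s = .var x := by
  cases s with
  | var y => cases h; rfl
  | func g ts => simp [root] at h

theorem root_subst {s : L.Term V} {g : FunSym L} (h : root s = .inr g) (σ : V → L.Term V) :
    root (s.subst σ) = .inr g := by
  cases s with
  | var x => simp [root] at h
  | func f ts => exact h

theorem not_isVar_subst {s : L.Term V} (h : ¬ IsVar s) (σ : V → L.Term V) :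
    ¬ IsVar (s.subst σ) :=
  let ⟨_, hg⟩ := exists_root_of_not_isVar h
  not_isVar_of_root (root_subst hg σ)

theorem RootGt.not_isVar_right {P : Precedence L} {s t : L.Term V} (h : RootGt P s t) :
    ¬ IsVar t := by
  obtain ⟨_, _, -, h, -⟩ := h
  exact not_isVar_of_root h

theorem RootGt.trans {P : Precedence L} {s t u : L.Term V} (h : RootGt P s t)
    (h' : RootGt P t u) : RootGt P s u := by
  obtain ⟨f, g, hf, hg, hfg⟩ := h
  obtain ⟨g', k, hg', hk, hgk⟩ := h'
  cases hg.symm.trans hg'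
  exact ⟨f, k, hf, hk, P.trans _ _ _ hfg hgk⟩

theorem RootGt.congr {P : Precedence L} {s s' t t' : L.Term V} (h : RootGt P s t)
    (hs : root s' = root s) (ht : root t' = root t) : RootGt P s' t' := by
  obtain ⟨f, g, hf, hg, hfg⟩ := h
  exact ⟨f, g, hs.trans hf, ht.trans hg, hfg⟩

theorem RootGt.subst {P : Precedence L} {s t : L.Term V} (h : RootGt P s t)
    (σ : V → L.Term V) : RootGt P (s.subst σ) (t.subst σ) := by
  obtain ⟨f, g, hf, hg, hfg⟩ := h
  exact ⟨f, g, root_subst hf σ, root_subst hg σ, hfg⟩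

variable (W : WeightFunction L)

theorem weight_arg_le {n : ℕ} (f : L.Functions n) (ts : Fin n → L.Term V) (i : Fin n) :
    weight W (ts i) ≤ weight W (.func f ts) := by
  rw [weight]
  exact (Finset.single_le_sum (f := fun i => weight W (ts i)) (fun _ _ => Nat.zero_le _)
    (Finset.mem_univ i)).trans (Nat.le_add_left _ _)

theorem w₀_le_weight (t : L.Term V) : W.w₀ ≤ weight W t := by
  induction t with
  | var x => exact le_rfl
  | @func n f ts ih =>
    cases n with
    | zero => simpa [weight] using W.w₀_le_const f
    | succ n => exact (ih 0).trans (weight_arg_le W f ts 0)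

theorem weight_pos (t : L.Term V) : 0 < weight W t := W.w₀_pos.trans_le (w₀_le_weight W t)

/-- A term has the weight of one of its arguments only below a unary symbol of weight zero, since
each further argument has positive weight. -/
theorem eq_one_of_weight_arg_eq {n : ℕ} {f : L.Functions n} {ts : Fin n → L.Term V} {i : Fin n}
    (h : weight W (.func f ts) = weight W (ts i)) : n = 1 ∧ W.w ⟨n, f⟩ = 0 := by
  rw [weight, ← Finset.add_sum_erase _ _ (Finset.mem_univ i)] at h
  refine ⟨?_, by omega⟩
  have h0 : ∑ j ∈ Finset.univ.erase i, weight W (ts j) = 0 := by omega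
  rw [Finset.sum_eq_zero_iff] at h0
  by_contra hn
  have : 1 < n := by have := i.pos; omega
  have : Nontrivial (Fin n) := Fin.nontrivial_iff_two_le.mpr this
  obtain ⟨j, hj⟩ := exists_ne i
  exact (weight_pos W (ts j)).ne' (h0 j (by simp [hj]))

theorem weight_subst (σ : V → L.Term V) (t : L.Term V) :
    weight W (t.subst σ) = weight W t + ((vars t).map fun x => weight W (σ x) - W.w₀).sum := by
  induction t with
  | var y =>
    have := w₀_le_weight W (σ y)
    simp only [Term.subst, weight, vars, Multiset.map_singleton, Multiset.sum_singleton]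
    omega
  | func f ts ih =>
    simp only [Term.subst, weight, vars, ih, Finset.sum_add_distrib, add_assoc]
    congr 2
    exact (map_sum (⟨⟨fun m : Multiset V => (m.map fun x => weight W (σ x) - W.w₀).sum, by simp⟩,
      by simp⟩ : Multiset V →+ ℕ) (fun i => vars (ts i)) Finset.univ).symm

variable {W}

theorem VarGe.weight_subst {s t : L.Term V} (h : VarGe s t) (σ : V → L.Term V) :
    weight W s + weight W (t.subst σ) ≤ weight W (s.subst σ) + weight W t := by
  obtain ⟨K, hK⟩ := Multiset.le_iff_exists_add.mp (varGe_iff_le.mp h)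
  rw [ACKBO.weight_subst, ACKBO.weight_subst, hK]
  simp only [Multiset.map_add, Multiset.sum_add]
  omega

theorem weight_update_add {n : ℕ} (f : L.Functions n) (ts : Fin n → L.Term V) (i : Fin n)
    (s t : L.Term V) :
    weight W (.func f (Function.update ts i s)) + weight W t =
      weight W (.func f (Function.update ts i t)) + weight W s := by
  have h : ∀ r, ∑ j ∈ Finset.univ.erase i, weight W (Function.update ts i r j) =
      ∑ j ∈ Finset.univ.erase i, weight W (ts j) := fun r =>
    Finset.sum_congr rfl fun j hj => by rw [Function.update_of_ne (Finset.ne_of_mem_erase hj)]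
  simp only [weight]
  rw [← Finset.add_sum_erase _ _ (Finset.mem_univ i),
    ← Finset.add_sum_erase (a := i) Finset.univ (fun j => weight W (Function.update ts i t j))
      (Finset.mem_univ i), h, h]
  simp only [Function.update_self]
  omega

theorem VarGe.update {n : ℕ} (f : L.Functions n) (ts : Fin n → L.Term V) (i : Fin n)
    {s t : L.Term V} (h : VarGe s t) :
    VarGe (.func f (Function.update ts i s)) (.func f (Function.update ts i t)) := by
  refine .func_of_forall f fun j => ?_
  rcases eq_or_ne j i with rfl | hj
  · simpa using h
  · simpa [hj] using VarGe.refl _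

end Basic

/-! ### Top-flattenings -/

section TopFlat

variable {L : FirstOrder.Language.{u, v}} {V : Type w} {W : WeightFunction L}

theorem topFlat_func (f : L.Functions 2) (ts : Fin 2 → L.Term V) :
    topFlat f (.func f ts) = topFlat f (ts 0) + topFlat f (ts 1) := by
  simp [topFlat]

theorem topFlat_of_root_ne {f : L.Functions 2} {t : L.Term V} (h : root t ≠ .inr ⟨2, f⟩) :
    topFlat f t = {t} := by
  cases t with
  | var x => simp [topFlat]
  | @func n g ts =>
    by_cases hn : n = 2
    · subst hn
      have : g ≠ f := fun hg => h (by rw [hg]; rfl)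
      simp [topFlat, this]
    · unfold topFlat
      split
      · rename_i heq; cases heq; exact (hn rfl).elim
      · rfl

/-- Induction along the top-flattening with respect to `f`. -/
theorem topFlat_induction (f : L.Functions 2) {motive : L.Term V → Prop}
    (flat : ∀ t, root t ≠ .inr ⟨2, f⟩ → motive t)
    (func : ∀ ts : Fin 2 → L.Term V, motive (ts 0) → motive (ts 1) → motive (.func f ts))
    (t : L.Term V) : motive t := by
  induction t with
  | var x => exact flat _ (by simp [root])
  | @func n g ts ih =>
    by_cases h : (⟨n, g⟩ : FunSym L) = ⟨2, f⟩
    · cases h; exact func ts (ih 0) (ih 1)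
    · exact flat _ fun h' => h (Sum.inr_injective h')

theorem topFlat_ne_zero (f : L.Functions 2) (t : L.Term V) : topFlat f t ≠ 0 := by
  induction t using topFlat_induction f with
  | flat t h => simp [topFlat_of_root_ne h]
  | func ts h _ => simp [topFlat_func, h]

theorem root_ne_of_mem_topFlat {f : L.Functions 2} {t u : L.Term V} (hu : u ∈ topFlat f t) :
    root u ≠ .inr ⟨2, f⟩ := by
  induction t using topFlat_induction f with
  | flat t h => rw [topFlat_of_root_ne h, mem_singleton] at hu; rwa [hu]
  | func ts h h' => rw [topFlat_func, mem_add] at hu; exact hu.elim h h'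

theorem weight_lt_func_two (f : L.Functions 2) (ts : Fin 2 → L.Term V) (i : Fin 2) :
    weight W (ts i) < weight W (.func f ts) :=
  (weight_arg_le W f ts i).lt_of_ne fun h => by
    have := (eq_one_of_weight_arg_eq W h.symm).1
    omega

theorem varGe_and_weight_le_of_mem_topFlat {f : L.Functions 2} {t u : L.Term V}
    (hu : u ∈ topFlat f t) : VarGe t u ∧ weight W u ≤ weight W t := by
  induction t using topFlat_induction f with
  | flat t h =>
    rw [topFlat_of_root_ne h, mem_singleton] at hu
    rw [hu]; exact ⟨.refl _, le_rfl⟩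
  | func ts h h' =>
    rw [topFlat_func, mem_add] at hu
    rcases hu with hu | hu
    · exact ⟨(varGe_arg f ts 0).trans (h hu).1, (h hu).2.trans (weight_arg_le W f ts 0)⟩
    · exact ⟨(varGe_arg f ts 1).trans (h' hu).1, (h' hu).2.trans (weight_arg_le W f ts 1)⟩

theorem weight_lt_of_mem_topFlat {f : L.Functions 2} {t u : L.Term V}
    (ht : root t = .inr ⟨2, f⟩) (hu : u ∈ topFlat f t) : weight W u < weight W t := by
  obtain ⟨ts, rfl⟩ := exists_func_of_root ht
  rw [topFlat_func, mem_add] at hu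
  rcases hu with hu | hu
  · exact (varGe_and_weight_le_of_mem_topFlat hu).2.trans_lt (weight_lt_func_two f ts 0)
  · exact (varGe_and_weight_le_of_mem_topFlat hu).2.trans_lt (weight_lt_func_two f ts 1)

theorem topFlat_subst (f : L.Functions 2) (σ : V → L.Term V) (t : L.Term V) :
    topFlat f (t.subst σ) = (topFlat f t).bind fun u => topFlat f (u.subst σ) := by
  induction t using topFlat_induction f with
  | flat t h => simp [topFlat_of_root_ne h]
  | func ts h h' => simp [topFlat_func, Term.subst, h, h']

end TopFlat

/-! ### The congruence generated by associativity and commutativity -/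

section ACEq

variable {L : FirstOrder.Language.{u, v}} {V : Type w} {AC : Set (L.Functions 2)}

theorem aCEq_trans (s t u : L.Term V) (h : ACEq AC s t) (h' : ACEq AC t u) : ACEq AC s u :=
  h.trans h'

theorem ACEq.subst {s t : L.Term V} (h : ACEq AC s t) (σ : V → L.Term V) :
    ACEq AC (s.subst σ) (t.subst σ) := by
  have aux : ∀ (f : L.Functions 2) (a b : L.Term V),
      (Term.func f ![a, b]).subst σ = Term.func f ![a.subst σ, b.subst σ] := fun f a b => by
    simp only [Term.subst]
    congr 1
    funext i
    fin_cases i <;> rfl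
  induction h with
  | comm f hf s t => rw [aux, aux]; exact .comm f hf _ _
  | assoc f hf s t u => simp only [aux]; exact .assoc f hf _ _ _
  | refl t => exact .refl _
  | symm _ ih => exact ih.symm
  | trans _ _ ih ih' => exact ih.trans ih'
  | congr f ss ts _ ih => exact .congr f _ _ ih

theorem ACEq.occ_eq {s t : L.Term V} (h : ACEq AC s t) (x : V) : occ x s = occ x t := by
  induction h with
  | comm f hf s t => simp [occ, add_comm]
  | assoc f hf s t u => simp [occ, add_assoc]
  | refl t => rfl
  | symm _ ih => exact ih.symm
  | trans _ _ ih ih' => exact ih.trans ih'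
  | congr f ss ts _ ih => simp [occ, ih]

theorem ACEq.weight_eq {s t : L.Term V} (h : ACEq AC s t) (W : WeightFunction L) :
    weight W s = weight W t := by
  induction h with
  | comm f hf s t => simp [weight, add_comm]
  | assoc f hf s t u => simp [weight]; omega
  | refl t => rfl
  | symm _ ih => exact ih.symm
  | trans _ _ ih ih' => exact ih.trans ih'
  | congr f ss ts _ ih => simp [weight, ih]

theorem ACEq.root_eq {s t : L.Term V} (h : ACEq AC s t) : root s = root t := by
  induction h with
  | comm f hf s t => rfl
  | assoc f hf s t u => rfl
  | refl t => rfl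
  | symm _ ih => exact ih.symm
  | trans _ _ ih ih' => exact ih.trans ih'
  | congr f ss ts _ ih => rfl

theorem ACEq.varGe {s t : L.Term V} (h : ACEq AC s t) : VarGe s t :=
  fun x => (h.occ_eq x).ge

theorem ACEq.isVar_iff {s t : L.Term V} (h : ACEq AC s t) : IsVar s ↔ IsVar t := by
  rw [isVar_iff_root, isVar_iff_root, h.root_eq]

theorem ACEq.rel_refl (M : Multiset (L.Term V)) : Multiset.Rel (ACEq AC) M M :=
  rel_refl_of_refl_on fun x _ => .refl x

theorem rel_aCEq_symm {M N : Multiset (L.Term V)} (h : Multiset.Rel (ACEq AC) M N) :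
    Multiset.Rel (ACEq AC) N M :=
  (rel_flip.mpr h).mono fun _ _ _ _ h => ACEq.symm h

theorem ACEq.rel_topFlat {s t : L.Term V} (h : ACEq AC s t) (f : L.Functions 2) :
    Multiset.Rel (ACEq AC) (topFlat f s) (topFlat f t) := by
  have hne : ∀ {a b : L.Term V}, root a ≠ .inr ⟨2, f⟩ → root a = root b → ACEq AC a b →
      Multiset.Rel (ACEq AC) (topFlat f a) (topFlat f b) := fun {a b} ha hr hab => by
    rw [topFlat_of_root_ne ha, topFlat_of_root_ne (hr ▸ ha)]
    exact .cons hab .zero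
  induction h with
  | comm g hg s t =>
    by_cases hf : g = f
    · subst hf
      simp only [topFlat_func, Matrix.cons_val_zero, Matrix.cons_val_one]
      rw [add_comm]
      exact ACEq.rel_refl _
    · exact hne (by simpa [root] using hf) rfl (.comm g hg s t)
  | assoc g hg s t u =>
    by_cases hf : g = f
    · subst hf
      simp only [topFlat_func, Matrix.cons_val_zero, Matrix.cons_val_one]
      rw [add_assoc]
      exact ACEq.rel_refl _
    · exact hne (by simpa [root] using hf) rfl (.assoc g hg s t u)
  | refl t => exact ACEq.rel_refl _
  | symm _ ih => exact rel_aCEq_symm ih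
  | trans _ _ ih ih' => exact rel_comp aCEq_trans ih ih'
  | @congr n g ss ts h ih =>
    by_cases hf : (⟨n, g⟩ : FunSym L) = ⟨2, f⟩
    · cases hf
      rw [topFlat_func, topFlat_func]
      exact (ih 0).add (ih 1)
    · exact hne (fun h' => hf (Sum.inr_injective h')) rfl (.congr g ss ts h)

/-- AC-equal terms whose common root is not an AC symbol have AC-equal arguments. -/
theorem ACEq.args {s t : L.Term V} (h : ACEq AC s t) {n : ℕ} {f : L.Functions n}
    (hf : ∀ g ∈ AC, (⟨n, f⟩ : FunSym L) ≠ ⟨2, g⟩) {ss ts : Fin n → L.Term V}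
    (hs : s = .func f ss) (ht : t = .func f ts) (i : Fin n) : ACEq AC (ss i) (ts i) := by
  induction h generalizing ss ts with
  | comm g hg s t => cases hs; exact (hf g hg rfl).elim
  | assoc g hg s t u => cases hs; exact (hf g hg rfl).elim
  | refl t => cases hs; cases ht; exact .refl _
  | symm _ ih => exact (ih ht hs).symm
  | @trans s t u h h' ih ih' =>
    obtain ⟨us, hu⟩ := exists_func_of_root (f := f) (h.root_eq.symm.trans (by rw [hs]; rfl))
    exact (ih hs hu).trans (ih' hu ht)
  | congr g ss' ts' h ih => cases hs; cases ht; exact h i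

end ACEq

/-! ### The auxiliary order pair -/

section Kv

variable {L : FirstOrder.Language.{u, v}} {V : Type w} {P : Precedence L} {W : WeightFunction L}

/-- A non-variable term that contains `x` and has the weight of a variable is a tower of unary
symbols of weight zero over `x`. By admissibility there is only one such symbol. -/
theorem exists_iterate_of_weight_eq (hadm : W.Admissible P) {s : L.Term V} {x : V}
    (hs : ¬ IsVar s) (hx : 1 ≤ occ x s) (hw : weight W s = W.w₀) :
    ∃ (f : L.Functions 1) (k : ℕ), W.w ⟨1, f⟩ = 0 ∧ 0 < k ∧
      s = (fun u : L.Term V => .func f ![u])^[k] (.var x) := by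
  induction s with
  | var y => exact (hs ⟨y, rfl⟩).elim
  | @func n g ts ih =>
    obtain ⟨i, hi⟩ : ∃ i, 1 ≤ occ x (ts i) := by
      by_contra! h
      rw [occ, Finset.sum_eq_zero fun i _ => by simpa using h i] at hx
      omega
    have hwi : weight W (ts i) = W.w₀ :=
      le_antisymm ((weight_arg_le W g ts i).trans hw.le) (w₀_le_weight W _)
    obtain ⟨rfl, hg⟩ := eq_one_of_weight_arg_eq W (hw.trans hwi.symm)
    obtain rfl := Subsingleton.elim i 0
    have hts : ts = ![ts 0] := by funext j; rw [Subsingleton.elim j 0]; rfl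
    by_cases hv : IsVar (ts 0)
    · obtain ⟨y, hy⟩ := hv
      rw [hy] at hi
      obtain rfl : y = x := by by_contra h; simp [occ, h] at hi
      exact ⟨g, 1, hg, one_pos, by rw [hts, hy]; rfl⟩
    · obtain ⟨f, k, hf, hk, h⟩ := ih 0 hv hi hwi
      obtain rfl : g = f := by
        by_contra hne
        have hne' : (⟨1, g⟩ : FunSym L) ≠ ⟨1, f⟩ := fun h => hne (by cases h; rfl)
        exact P.irrefl _ (P.trans _ _ _ (hadm g hg _ hne'.symm) (hadm f hf _ hne'))
      exact ⟨g, k + 1, hg, k.succ_pos, by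
        rw [Function.iterate_succ_apply', ← h, ← hts]⟩

theorem root_of_weight_eq (hadm : W.Admissible P) {s : L.Term V} {x : V}
    (hs : ¬ IsVar s) (hx : 1 ≤ occ x s) (hw : weight W s = W.w₀) :
    ∃ f : L.Functions 1, root s = .inr ⟨1, f⟩ ∧ ∀ g, g ≠ ⟨1, f⟩ → P.gt ⟨1, f⟩ g := by
  obtain ⟨f, k, hf, hk, rfl⟩ := exists_iterate_of_weight_eq hadm hs hx hw
  obtain ⟨k, rfl⟩ := Nat.exists_eq_succ_of_ne_zero hk.ne'
  exact ⟨f, by rw [Function.iterate_succ_apply']; rfl, hadm f hf⟩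

theorem KvGe.weight_le {s t : L.Term V} (h : KvGe P W s t) : weight W t ≤ weight W s := by
  rcases h.2 with h | h
  exacts [h.le, h.1.ge]

theorem WRootGt.weight_le {s t : L.Term V} (h : WRootGt P W s t) :
    weight W t ≤ weight W s := by
  rcases h.2 with h | h
  exacts [h.le, h.1.ge]

theorem WRootEq.kvGe {s t : L.Term V} (h : WRootEq W s t) : KvGe P W s t :=
  ⟨fun x => (h.1 x).ge, .inr ⟨h.2.1, .inl (.inr h.2.2)⟩⟩

theorem ACEq.kvGe {AC : Set (L.Functions 2)} {s t : L.Term V} (h : ACEq AC s t) :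
    KvGe P W s t :=
  WRootEq.kvGe ⟨h.occ_eq, h.weight_eq W, h.root_eq⟩

/-- The relations `≥_{kv'}` and `>_{w,root}` form an order pair. Admissibility excludes
`s >_{w,root} t ≥_{kv'} x` for three terms of equal weight, where the roots of `s` and `x` would
be incomparable. -/
theorem orderPair_kvGe (hadm : W.Admissible P) :
    OrderPair (KvGe P W : L.Term V → L.Term V → Prop) (WRootGt P W) where
  refl s := ⟨.refl s, .inr ⟨rfl, .inl (.inr rfl)⟩⟩
  ge_ge s t u h h' := by
    refine ⟨h.1.trans h'.1, ?_⟩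
    rcases (h'.weight_le.trans h.weight_le).lt_or_eq with hw | hw
    · exact .inl hw
    have hw₁ : weight W s = weight W t := le_antisymm (hw ▸ h'.weight_le) h.weight_le
    obtain ⟨-, h₁⟩ := h.2.resolve_left (by omega)
    obtain ⟨-, h₂⟩ := h'.2.resolve_left (by omega)
    refine .inr ⟨hw.symm, ?_⟩
    rcases h₂ with (h₂ | h₂) | h₂
    · rcases h₁ with (h₁ | h₁) | h₁
      · exact .inl (.inl (h₁.trans h₂))
      · exact .inl (.inl (h₂.congr h₁ rfl))
      · obtain ⟨_, _, h₂, -⟩ := h₂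
        exact (not_isVar_of_root h₂ h₁).elim
    · rcases h₁ with (h₁ | h₁) | h₁
      · exact .inl (.inl (h₁.congr rfl h₂.symm))
      · exact .inl (.inr (h₁.trans h₂))
      · exact .inr (by rwa [isVar_iff_root, ← h₂, ← isVar_iff_root])
    · exact .inr h₂
  gt_ge s t u h h' := by
    refine ⟨h.1.trans h'.1, ?_⟩
    rcases (h'.weight_le.trans h.weight_le).lt_or_eq with hw | hw
    · exact .inl hw
    have hw₁ : weight W s = weight W t := le_antisymm (hw ▸ h'.weight_le) h.weight_le
    obtain ⟨-, h₁⟩ := h.2.resolve_left (by omega)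
    obtain ⟨-, h₂⟩ := h'.2.resolve_left (by omega)
    refine .inr ⟨hw.symm, ?_⟩
    rcases h₂ with (h₂ | h₂) | ⟨x, rfl⟩
    · exact h₁.trans h₂
    · exact h₁.congr rfl h₂.symm
    · have ht : ¬ IsVar t := h₁.not_isVar_right
      obtain ⟨f, hf, hmax⟩ :=
        root_of_weight_eq hadm ht h'.1.one_le_occ (hw₁.symm.trans hw.symm)
      obtain ⟨g, g', hg, hg', hgt⟩ := h₁
      obtain rfl : (⟨1, f⟩ : FunSym L) = g' := Sum.inr_injective (hf.symm.trans hg')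
      exact (P.irrefl _ (P.trans _ _ _ hgt
        (hmax g fun h => P.irrefl _ (by rwa [h] at hgt)))).elim
  ge_gt s t u h h' := by
    refine ⟨h.1.trans h'.1, ?_⟩
    rcases (h'.weight_le.trans h.weight_le).lt_or_eq with hw | hw
    · exact .inl hw
    have hw₁ : weight W s = weight W t := le_antisymm (hw ▸ h'.weight_le) h.weight_le
    obtain ⟨-, h₁⟩ := h.2.resolve_left (by omega)
    obtain ⟨-, h₂⟩ := h'.2.resolve_left (by omega)
    refine .inr ⟨hw.symm, ?_⟩
    rcases h₁ with (h₁ | h₁) | h₁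
    · exact h₁.trans h₂
    · exact h₂.congr h₁ rfl
    · obtain ⟨_, _, h₂, -⟩ := h₂
      exact (not_isVar_of_root h₂ h₁).elim
  gt_gt s t u h h' := by
    refine ⟨h.1.trans h'.1, ?_⟩
    rcases (h'.weight_le.trans h.weight_le).lt_or_eq with hw | hw
    · exact .inl hw
    have hw₁ : weight W s = weight W t := le_antisymm (hw ▸ h'.weight_le) h.weight_le
    obtain ⟨-, h₁⟩ := h.2.resolve_left (by omega)
    obtain ⟨-, h₂⟩ := h'.2.resolve_left (by omega)
    exact .inr ⟨hw.symm, h₁.trans h₂⟩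

theorem KvGe.subst (hadm : W.Admissible P) {s t : L.Term V} (h : KvGe P W s t)
    (σ : V → L.Term V) : KvGe P W (s.subst σ) (t.subst σ) := by
  have hw := h.1.weight_subst (W := W) σ
  refine ⟨h.1.subst σ, ?_⟩
  rcases h.2 with h' | ⟨hst, h'⟩
  · left; omega
  rcases (show weight W (t.subst σ) ≤ weight W (s.subst σ) by omega).lt_or_eq with h'' | h''
  · exact .inl h''
  refine .inr ⟨h''.symm, ?_⟩
  rcases h' with (h' | h') | ⟨x, rfl⟩
  · exact .inl (.inl (h'.subst σ))
  · rcases hr : root s with x | g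
    · rw [exists_var_of_root hr, exists_var_of_root (h'.symm.trans hr)]
      exact .inl (.inr rfl)
    · exact .inl (.inr ((root_subst hr σ).trans (root_subst (h'.symm.trans hr) σ).symm))
  · by_cases hs : IsVar s
    · obtain ⟨y, rfl⟩ := hs
      have : y = x := by
        by_contra hne
        simpa [occ, hne] using h.1 x
      exact .inl (.inr (by rw [this]))
    by_cases hv : IsVar ((Term.var x : L.Term V).subst σ)
    · exact .inr hv
    obtain ⟨f, hf, hmax⟩ := root_of_weight_eq hadm hs h.1.one_le_occ hst
    obtain ⟨g, hg⟩ := exists_root_of_not_isVar hv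
    by_cases hgf : g = ⟨1, f⟩
    · exact .inl (.inr (by rw [root_subst hf, hg, hgf]))
    · exact .inl (.inl ⟨_, _, root_subst hf σ, hg, hmax g hgf⟩)

theorem WRootGt.subst {s t : L.Term V} (h : WRootGt P W s t) (σ : V → L.Term V) :
    WRootGt P W (s.subst σ) (t.subst σ) := by
  have hw := h.1.weight_subst (W := W) σ
  refine ⟨h.1.subst σ, ?_⟩
  rcases h.2 with h' | ⟨hst, h'⟩
  · left; omega
  rcases (show weight W (t.subst σ) ≤ weight W (s.subst σ) by omega).lt_or_eq with h'' | h''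
  · exact .inl h''
  · exact .inr ⟨h''.symm, h'.subst σ⟩

theorem wf_precedence [Finite (FunSym L)] (P : Precedence L) :
    WellFounded fun g f => P.gt f g := by
  have : IsTrans (FunSym L) fun g f => P.gt f g := ⟨fun a b c h h' => P.trans _ _ _ h' h⟩
  have : Std.Irrefl fun g f : FunSym L => P.gt f g := ⟨P.irrefl⟩
  exact Finite.wellFounded_of_trans_of_irrefl _

theorem wf_wRootGt [Finite (FunSym L)] :
    WellFounded fun t s : L.Term V => WRootGt P W s t := by
  suffices h : ∀ (n : ℕ) (s : L.Term V), weight W s = n →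
      Acc (fun t s => WRootGt P W s t) s from ⟨fun s => h _ s rfl⟩
  intro n
  induction n using Nat.strong_induction_on with
  | _ n ih =>
  have hroot : ∀ f : FunSym L, ∀ s : L.Term V, root s = .inr f → weight W s = n →
      Acc (fun t s => WRootGt P W s t) s := by
    intro f
    induction f using (wf_precedence P).induction with
    | _ f ih' =>
    rintro s hs rfl
    refine ⟨_, fun t ht => ?_⟩
    rcases ht.2 with h | ⟨hw, f', g, hf, hg, hfg⟩
    · exact ih _ h t rfl
    · cases hs.symm.trans hf
      exact ih' g hfg t hg hw.symm
  rintro s rfl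
  refine ⟨_, fun t ht => ?_⟩
  rcases ht.2 with h | ⟨hw, f, g, -, hg, -⟩
  · exact ih _ h t rfl
  · exact hroot g t hg hw.symm

end Kv

/-! ### Comparison of top-flattenings -/

section Flat

open scoped Classical

variable {L : FirstOrder.Language.{u, v}} {V : Type w} {AC : Set (L.Functions 2)}
  {P : Precedence L} {W : WeightFunction L}

variable (P) in
/-- A non-variable term whose root is not smaller than `f`. -/
def NotLt (f : FunSym L) (t : L.Term V) : Prop := ∃ g : FunSym L, root t = Sum.inr g ∧ ¬ P.gt f g

theorem notLtPart_cons_of_pos {f : FunSym L} {t : L.Term V} (h : NotLt P f t)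
    (S : Multiset (L.Term V)) : notLtPart P f (t ::ₘ S) = t ::ₘ notLtPart P f S :=
  filter_cons_of_pos (p := NotLt P f) S h

theorem notLtPart_cons_of_neg {f : FunSym L} {t : L.Term V} (h : ¬ NotLt P f t)
    (S : Multiset (L.Term V)) : notLtPart P f (t ::ₘ S) = notLtPart P f S :=
  filter_cons_of_neg (p := NotLt P f) S h

theorem varPart_cons_of_pos {t : L.Term V} (h : IsVar t) (S : Multiset (L.Term V)) :
    varPart (t ::ₘ S) = t ::ₘ varPart S :=
  filter_cons_of_pos S h

theorem varPart_cons_of_neg {t : L.Term V} (h : ¬ IsVar t) (S : Multiset (L.Term V)) :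
    varPart (t ::ₘ S) = varPart S :=
  filter_cons_of_neg S h

theorem mem_notLtPart {f : FunSym L} {S : Multiset (L.Term V)} {t : L.Term V} :
    t ∈ notLtPart P f S ↔ t ∈ S ∧ NotLt P f t :=
  mem_filter

theorem notLtPart_singleton_of_pos {f : FunSym L} {t : L.Term V} (h : NotLt P f t) :
    notLtPart P f {t} = {t} :=
  notLtPart_cons_of_pos h 0

theorem notLtPart_singleton_of_neg {f : FunSym L} {t : L.Term V} (h : ¬ NotLt P f t) :
    notLtPart P f {t} = 0 :=
  notLtPart_cons_of_neg h 0

theorem varPart_singleton_of_neg {t : L.Term V} (h : ¬ IsVar t) : varPart {t} = 0 :=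
  varPart_cons_of_neg h 0

theorem NotLt.not_isVar {f : FunSym L} {t : L.Term V} (h : NotLt P f t) : ¬ IsVar t :=
  let ⟨_, hg, _⟩ := h
  not_isVar_of_root hg

theorem notLtPart_add (f : FunSym L) (S T : Multiset (L.Term V)) :
    notLtPart P f (S + T) = notLtPart P f S + notLtPart P f T :=
  filter_add ..

theorem varPart_add (S T : Multiset (L.Term V)) : varPart (S + T) = varPart S + varPart T :=
  filter_add ..

theorem notLtPart_add_varPart_le (f : FunSym L) (T : Multiset (L.Term V)) :
    notLtPart P f T + varPart T ≤ T := by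
  have : filter (fun t => NotLt P f t ∧ IsVar t) T = 0 :=
    filter_eq_nil.mpr fun t _ h => h.1.not_isVar h.2
  exact (filter_add_filter (NotLt P f) IsVar T).trans_le
    (by rw [this, add_zero]; exact filter_le _ _)

theorem rhsPart_le_right (f : FunSym L) (S T : Multiset (L.Term V)) : rhsPart P f S T ≤ T :=
  (add_le_add le_rfl tsub_le_self).trans (notLtPart_add_varPart_le f T)

theorem rhsPart_singleton_eq_zero {f : FunSym L} {t : L.Term V} (h : ¬ NotLt P f t)
    (h' : ¬ IsVar t) (S : Multiset (L.Term V)) : rhsPart P f S {t} = 0 := by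
  rw [rhsPart, notLtPart_singleton_of_neg h, varPart_singleton_of_neg h', zero_tsub, add_zero]

variable (P W) in
/-- `S ≥^f T` for the order pair `≥_{kv'}`, `>_{w,root}`. -/
def FlatGe (f : L.Functions 2) (S T : Multiset (L.Term V)) : Prop :=
  MulGe (KvGe P W) (WRootGt P W) (notLtPart P ⟨2, f⟩ S) (rhsPart P ⟨2, f⟩ S T)

variable (P W) in
/-- `S >^f T` for the order pair `≥_{kv'}`, `>_{w,root}`. -/
def FlatGt (f : L.Functions 2) (S T : Multiset (L.Term V)) : Prop :=
  MulGt (KvGe P W) (WRootGt P W) (notLtPart P ⟨2, f⟩ S) (rhsPart P ⟨2, f⟩ S T)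

variable (AC P W) in
/-- The comparison of top-flattenings of terms with the same AC root symbol `f`, with `R` in place
of recursive calls. -/
def FlatStep (R : L.Term V → L.Term V → Prop) (f : L.Functions 2)
    (S T : Multiset (L.Term V)) : Prop :=
  FlatGt P W f S T ∨ (FlatGe P W f S T ∧ (card T < card S ∨
    (card S = card T ∧ MulGt (ACEq AC) R S T)))

variable {f : L.Functions 2} {S S' T U K : Multiset (L.Term V)}

theorem rhsPart_le (f : FunSym L) (S T U : Multiset (L.Term V)) :
    rhsPart P f S U ≤ rhsPart P f T U + (varPart T - varPart S) := by
  rw [rhsPart, rhsPart, add_assoc]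
  refine add_le_add le_rfl ?_
  rw [le_iff_count]
  intro x
  simp only [count_add, count_sub]
  omega

/-- Transitivity of comparisons of top-flattenings: the variables that are missing on the left
of the second comparison are carried along on both sides. -/
theorem FlatGe.trans (hadm : W.Admissible P) (h : FlatGe P W f S T) (h' : FlatGe P W f T U) :
    FlatGe P W f S U := by
  have hp := orderPair_kvGe (V := V) hadm
  exact hp.mulGe_trans h (hp.mulGe_trans (h'.add (hp.mulGe_refl _))
    (hp.mulGe_of_le (rhsPart_le ..)))

theorem FlatGt.trans_flatGe (hadm : W.Admissible P) (h : FlatGt P W f S T)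
    (h' : FlatGe P W f T U) : FlatGt P W f S U := by
  have hp := orderPair_kvGe (V := V) hadm
  exact hp.mulGt_mulGe_trans h (hp.mulGe_trans (h'.add (hp.mulGe_refl _))
    (hp.mulGe_of_le (rhsPart_le ..)))

theorem FlatGe.trans_flatGt (hadm : W.Admissible P) (h : FlatGe P W f S T)
    (h' : FlatGt P W f T U) : FlatGt P W f S U := by
  have hp := orderPair_kvGe (V := V) hadm
  exact hp.mulGe_mulGt_trans h (hp.mulGt_mulGe_trans (h'.add_mulGe (hp.mulGe_refl _))
    (hp.mulGe_of_le (rhsPart_le ..)))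

theorem FlatGt.flatGe (h : FlatGt P W f S T) : FlatGe P W f S T := MulGt.mulGe h

theorem FlatGe.mulGe_notLtPart (hadm : W.Admissible P) (h : FlatGe P W f S T) :
    MulGe (KvGe P W) (WRootGt P W) (notLtPart P ⟨2, f⟩ S) (notLtPart P ⟨2, f⟩ T) := by
  have hp := orderPair_kvGe (V := V) hadm
  exact hp.mulGe_trans h (hp.mulGe_of_le (Multiset.le_add_right _ _))

theorem FlatGt.mulGt_notLtPart (hadm : W.Admissible P) (h : FlatGt P W f S T) :
    MulGt (KvGe P W) (WRootGt P W) (notLtPart P ⟨2, f⟩ S) (notLtPart P ⟨2, f⟩ T) := by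
  have hp := orderPair_kvGe (V := V) hadm
  exact hp.mulGt_mulGe_trans h (hp.mulGe_of_le (Multiset.le_add_right _ _))

theorem rhsPart_add_add (f : FunSym L) (S T K : Multiset (L.Term V)) :
    rhsPart P f (S + K) (T + K) = rhsPart P f S T + notLtPart P f K := by
  rw [rhsPart, rhsPart, notLtPart_add, varPart_add, varPart_add, add_tsub_add_eq_tsub_right,
    add_right_comm]

theorem FlatGe.add_right (hadm : W.Admissible P) (h : FlatGe P W f S T) :
    FlatGe P W f (S + K) (T + K) := by
  rw [FlatGe, rhsPart_add_add, notLtPart_add]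
  exact MulGe.add h ((orderPair_kvGe hadm).mulGe_refl _)

theorem FlatGt.add_right (hadm : W.Admissible P) (h : FlatGt P W f S T) :
    FlatGt P W f (S + K) (T + K) := by
  rw [FlatGt, rhsPart_add_add, notLtPart_add]
  exact MulGt.add_mulGe h ((orderPair_kvGe hadm).mulGe_refl _)

theorem FlatStep.flatGe {R : L.Term V → L.Term V → Prop} (h : FlatStep AC P W R f S T) :
    FlatGe P W f S T :=
  h.elim FlatGt.flatGe And.left

theorem FlatStep.add_right (hadm : W.Admissible P) {R : L.Term V → L.Term V → Prop}
    (h : FlatStep AC P W R f S T) : FlatStep AC P W R f (S + K) (T + K) := by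
  rcases h with h | ⟨h, h' | ⟨h', h''⟩⟩
  · exact .inl (h.add_right hadm)
  · exact .inr ⟨h.add_right hadm, .inl (by simpa using h')⟩
  · exact .inr ⟨h.add_right hadm, .inr ⟨by simpa using h',
      h''.add_mulGe (.of_rel (ACEq.rel_refl _))⟩⟩

theorem FlatStep.comp (hadm : W.Admissible P) {R₁ R₂ R₃ : L.Term V → L.Term V → Prop}
    (h₁ : ∀ a b c, R₁ a b → ACEq AC b c → R₃ a c)
    (h₂ : ∀ a b c, ACEq AC a b → R₂ b c → R₃ a c)
    (h₁₂ : ∀ a b c, R₁ a b → R₂ b c → R₃ a c)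
    (h : FlatStep AC P W R₁ f S T) (h' : FlatStep AC P W R₂ f T U) :
    FlatStep AC P W R₃ f S U := by
  rcases h with h | ⟨hge, h⟩
  · exact .inl (h.trans_flatGe hadm h'.flatGe)
  rcases h' with h' | ⟨hge', h'⟩
  · exact .inl (hge.trans_flatGt hadm h')
  refine .inr ⟨hge.trans hadm hge', ?_⟩
  rcases h with h | ⟨hc, h⟩ <;> rcases h' with h' | ⟨hc', h'⟩
  · exact .inl (h'.trans h)
  · exact .inl (hc' ▸ h)
  · exact .inl (hc ▸ h')
  · exact .inr ⟨hc.trans hc', h.comp aCEq_trans h₁ h₂ h₁₂ h'⟩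

/-- AC-equal multisets contain the same variables, and the terms selected for the comparison with
respect to `f` are again AC-equal. -/
theorem flatGe_of_rel (h : Multiset.Rel (ACEq AC) S T) : FlatGe P W f S T := by
  have hv : varPart S = varPart T := by
    induction h with
    | zero => rfl
    | @cons a b as bs hab _ ih =>
      by_cases ha : IsVar a
      · rw [varPart_cons_of_pos ha, varPart_cons_of_pos (hab.isVar_iff.mp ha), ih]
        obtain ⟨x, rfl⟩ := ha
        rw [exists_var_of_root (hab.root_eq.symm.trans rfl)]
      · rw [varPart_cons_of_neg ha, varPart_cons_of_neg (mt hab.isVar_iff.mpr ha), ih]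
  rw [FlatGe, rhsPart, hv, tsub_self, add_zero]
  refine .of_rel ?_
  clear hv
  induction h with
  | zero => exact .zero
  | @cons a b as bs hab _ ih =>
    have hiff : NotLt P ⟨2, f⟩ a ↔ NotLt P ⟨2, f⟩ b := by rw [NotLt, NotLt, hab.root_eq]
    by_cases ha : NotLt P ⟨2, f⟩ a
    · rw [notLtPart_cons_of_pos ha, notLtPart_cons_of_pos (hiff.mp ha)]
      exact .cons hab.kvGe ih
    · rw [notLtPart_cons_of_neg ha, notLtPart_cons_of_neg (mt hiff.mpr ha)]
      exact ih

theorem FlatStep.comp_rel (hadm : W.Admissible P) {R R' : L.Term V → L.Term V → Prop}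
    (hR : ∀ a b c, R a b → ACEq AC b c → R' a c) (h : FlatStep AC P W R f S T)
    (h' : Multiset.Rel (ACEq AC) T U) : FlatStep AC P W R' f S U := by
  rcases h with h | ⟨hge, h⟩
  · exact .inl (h.trans_flatGe hadm (flatGe_of_rel h'))
  refine .inr ⟨hge.trans hadm (flatGe_of_rel h'), ?_⟩
  rw [← card_eq_card_of_rel h']
  exact h.imp_right fun h => ⟨h.1, h.2.rel_comp aCEq_trans hR h'⟩

theorem FlatStep.rel_comp (hadm : W.Admissible P) {R R' : L.Term V → L.Term V → Prop}
    (hR : ∀ a b c, ACEq AC a b → R b c → R' a c) (h : Multiset.Rel (ACEq AC) S T)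
    (h' : FlatStep AC P W R f T U) : FlatStep AC P W R' f S U := by
  rcases h' with h' | ⟨hge, h'⟩
  · exact .inl ((flatGe_of_rel h).trans_flatGt hadm h')
  refine .inr ⟨(flatGe_of_rel h).trans hadm hge, ?_⟩
  rw [card_eq_card_of_rel h]
  exact h'.imp_right fun h' => ⟨h'.1, h'.2.comp_rel aCEq_trans hR h⟩

end Flat

/-! ### A recursive characterization of `>_KV'` -/

section Characterization

variable {L : FirstOrder.Language.{u, v}} {V : Type w} {AC : Set (L.Functions 2)}
  {P : Precedence L} {W : WeightFunction L} {R : L.Term V → L.Term V → Prop} {s t : L.Term V}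

variable (AC P W R) in
/-- The alternatives for terms of equal weight in the definition of `>_KV'`, for a non-variable
left-hand side `s`. Every variable `t` is allowed, as `s` is then a tower over `t`. -/
def Decrease (s t : L.Term V) : Prop :=
  IsVar t ∨ RootGt P s t ∨
  (∃ (n : ℕ) (f : L.Functions n) (ss ts : Fin n → L.Term V), s = .func f ss ∧ t = .func f ts ∧
    (∀ h ∈ AC, (⟨n, f⟩ : FunSym L) ≠ ⟨2, h⟩) ∧ LexGt (ACEq AC) R ss ts) ∨
  (∃ f ∈ AC, root s = .inr ⟨2, f⟩ ∧ root t = .inr ⟨2, f⟩ ∧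
    FlatStep AC P W R f (topFlat f s) (topFlat f t))

theorem not_isVar_of_alternative {ge : L.Term V → L.Term V → Prop}
    (h : Alternative AC P W ge R s t) : ¬ IsVar s := by
  cases h with
  | case0 f x k hk =>
    obtain ⟨k, rfl⟩ := Nat.exists_eq_succ_of_ne_zero hk.ne'
    rw [Function.iterate_succ_apply']
    exact not_isVar_func _ _
  | _ => exact not_isVar_func _ _

theorem decrease_of_alternative (h : Alternative AC P W (KvGe P W) R s t) :
    Decrease AC P W R s t := by
  cases h with
  | case0 f x k hk => exact .inl ⟨x, rfl⟩
  | case1 f g ss ts hfg => exact .inr (.inl ⟨_, _, rfl, rfl, hfg⟩)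
  | case2 f ss ts hf hlex => exact .inr (.inr (.inl ⟨_, f, ss, ts, rfl, rfl, hf, hlex⟩))
  | case3a f hf ss ts h => exact .inr (.inr (.inr ⟨f, hf, rfl, rfl, .inl h⟩))
  | case3b f hf ss ts h hcard =>
    exact .inr (.inr (.inr ⟨f, hf, rfl, rfl, .inr ⟨h, .inl hcard⟩⟩))
  | case3c f hf ss ts h hcard hmul =>
    exact .inr (.inr (.inr ⟨f, hf, rfl, rfl, .inr ⟨h, .inr ⟨hcard, hmul⟩⟩⟩))

theorem alternative_of_decrease (hadm : W.Admissible P) (hs : ¬ IsVar s) (hv : VarGe s t)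
    (hw : weight W s = weight W t) (h : Decrease AC P W R s t) :
    Alternative AC P W (KvGe P W) R s t := by
  rcases h with ⟨x, rfl⟩ | ⟨⟨n, f⟩, ⟨m, g⟩, hf, hg, hfg⟩ | ⟨n, f, ss, ts, rfl, rfl, hf, h⟩ |
    ⟨f, hf, hs', ht', h⟩
  · obtain ⟨f, k, -, hk, rfl⟩ := exists_iterate_of_weight_eq hadm hs hv.one_le_occ hw
    exact .case0 f x k hk
  · obtain ⟨ss, rfl⟩ := exists_func_of_root hf
    obtain ⟨ts, rfl⟩ := exists_func_of_root hg
    exact .case1 f g ss ts hfg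
  · exact .case2 f ss ts hf h
  · obtain ⟨ss, rfl⟩ := exists_func_of_root hs'
    obtain ⟨ts, rfl⟩ := exists_func_of_root ht'
    rcases h with h | ⟨h, h' | ⟨h', h''⟩⟩
    · exact .case3a f hf ss ts h
    · exact .case3b f hf ss ts h h'
    · exact .case3c f hf ss ts h h' h''

theorem not_isVar_of_step (h : Step AC P W (KvGe P W) R s t) : ¬ IsVar s := by
  rcases h.2 with hw | ⟨-, h'⟩
  · rintro ⟨x, rfl⟩
    exact hw.not_ge (w₀_le_weight W t)
  · exact not_isVar_of_alternative h'

theorem step_iff (hadm : W.Admissible P) : Step AC P W (KvGe P W) R s t ↔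
    ¬ IsVar s ∧ VarGe s t ∧ (weight W t < weight W s ∨
      (weight W s = weight W t ∧ Decrease AC P W R s t)) := by
  constructor
  · exact fun h => ⟨not_isVar_of_step h, h.1,
      h.2.imp_right fun h => ⟨h.1, decrease_of_alternative h.2⟩⟩
  · rintro ⟨hs, hv, h⟩
    exact ⟨hv, h.imp_right fun h => ⟨h.1, alternative_of_decrease hadm hs hv h.1 h.2⟩⟩

theorem kv'_iff (hadm : W.Admissible P) : KV' AC P W s t ↔
    ¬ IsVar s ∧ VarGe s t ∧ (weight W t < weight W s ∨
      (weight W s = weight W t ∧ Decrease AC P W (KV' AC P W) s t)) :=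
  (kvScheme_iff s t).trans (step_iff hadm)

theorem KV'.not_isVar (h : KV' AC P W s t) : ¬ IsVar s :=
  not_isVar_of_step ((kvScheme_iff s t).mp h)

theorem KV'.varGe (h : KV' AC P W s t) : VarGe s t := ((kvScheme_iff s t).mp h).1

theorem KV'.weight_le (h : KV' AC P W s t) : weight W t ≤ weight W s := by
  rcases ((kvScheme_iff s t).mp h).2 with h | h
  exacts [h.le, h.1.ge]

/-- A comparison at equal weight weakly decreases the root. -/
theorem Decrease.root (h : Decrease AC P W R s t) : RootGt P s t ∨ root s = root t ∨ IsVar t := by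
  rcases h with h | h | ⟨n, f, ss, ts, rfl, rfl, -⟩ | ⟨f, -, hs, ht, -⟩
  · exact .inr (.inr h)
  · exact .inl h
  · exact .inr (.inl rfl)
  · exact .inr (.inl (hs.trans ht.symm))

end Characterization

/-! ### Compatibility with AC and transitivity -/

section Trans

variable {L : FirstOrder.Language.{u, v}} {V : Type w} {AC : Set (L.Functions 2)}
  {P : Precedence L} {W : WeightFunction L} {R R₁ R₂ R₃ : L.Term V → L.Term V → Prop}
  {s t u : L.Term V}

theorem Decrease.comp_aCEq (hadm : W.Admissible P)
    (hR : ∀ a b c, R a b → ACEq AC b c → R₃ a c) (h : Decrease AC P W R s t)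
    (h' : ACEq AC t u) : Decrease AC P W R₃ s u := by
  rcases h with h | h | ⟨n, f, ss, ts, rfl, rfl, hf, h⟩ | ⟨f, hf, hs, ht, h⟩
  · exact .inl (h'.isVar_iff.mp h)
  · exact .inr (.inl (h.congr rfl h'.root_eq.symm))
  · obtain ⟨us, rfl⟩ := exists_func_of_root (f := f) h'.root_eq.symm
    obtain ⟨k, hk, hk'⟩ := h
    exact .inr (.inr (.inl ⟨n, f, ss, us, rfl, rfl, hf, k,
      fun i hi => (hk i hi).trans (h'.args hf rfl rfl i), hR _ _ _ hk' (h'.args hf rfl rfl k)⟩))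
  · exact .inr (.inr (.inr ⟨f, hf, hs, h'.root_eq.symm.trans ht,
      h.comp_rel hadm hR (h'.rel_topFlat f)⟩))

theorem Decrease.aCEq_comp (hadm : W.Admissible P)
    (hR : ∀ a b c, ACEq AC a b → R b c → R₃ a c) (h : ACEq AC s t)
    (h' : Decrease AC P W R t u) : Decrease AC P W R₃ s u := by
  rcases h' with h' | h' | ⟨n, f, ts, us, rfl, rfl, hf, h'⟩ | ⟨f, hf, hs, ht, h'⟩
  · exact .inl h'
  · exact .inr (.inl (h'.congr h.root_eq rfl))
  · obtain ⟨ss, rfl⟩ := exists_func_of_root (f := f) h.root_eq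
    obtain ⟨k, hk, hk'⟩ := h'
    exact .inr (.inr (.inl ⟨n, f, ss, us, rfl, rfl, hf, k,
      fun i hi => (h.args hf rfl rfl i).trans (hk i hi), hR _ _ _ (h.args hf rfl rfl k) hk'⟩))
  · exact .inr (.inr (.inr ⟨f, hf, h.root_eq.trans hs, ht,
      h'.rel_comp hadm hR (h.rel_topFlat f)⟩))

/-- Composition of two comparisons at equal weight. -/
theorem Decrease.comp (hadm : W.Admissible P)
    (h₁ : ∀ a b c, R₁ a b → ACEq AC b c → R₃ a c)
    (h₂ : ∀ a b c, ACEq AC a b → R₂ b c → R₃ a c)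
    (h₁₂ : ∀ a b c, R₁ a b → R₂ b c → R₃ a c) (ht : ¬ IsVar t)
    (h : Decrease AC P W R₁ s t) (h' : Decrease AC P W R₂ t u) : Decrease AC P W R₃ s u := by
  have hst := h.root
  rcases h' with h' | h' | ⟨n, f, ts, us, rfl, rfl, hf, h'⟩ | ⟨f, hf, ht', hu, h'⟩
  · exact .inl h'
  · rcases hst with hst | hst | hst
    · exact .inr (.inl (hst.trans h'))
    · exact .inr (.inl (h'.congr hst rfl))
    · exact (ht hst).elim
  · rcases h with h | h | ⟨m, g, ss, ts', rfl, hts, hg, h⟩ | ⟨g, hg, hs, ht', h⟩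
    · exact (ht h).elim
    · exact .inr (.inl (h.congr rfl rfl))
    · cases hts
      exact .inr (.inr (.inl ⟨n, f, ss, us, rfl, rfl, hf, h.comp aCEq_trans h₁ h₂ h₁₂ h'⟩))
    · cases ht'
      exact (hf g hg rfl).elim
  · rcases h with h | h | ⟨m, g, ss, ts', rfl, rfl, hg, h⟩ | ⟨g, hg, hs, ht'', h⟩
    · exact (ht h).elim
    · exact .inr (.inl (h.congr rfl (hu.trans ht'.symm)))
    · cases ht'
      exact (hg f hf rfl).elim
    · cases ht''.symm.trans ht'
      exact .inr (.inr (.inr ⟨f, hf, hs, hu, h.comp hadm h₁ h₂ h₁₂ h'⟩))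

theorem KV'.comp_aCEq (hadm : W.Admissible P) (h : KV' AC P W s t) (h' : ACEq AC t u) :
    KV' AC P W s u := by
  induction h generalizing u with
  | intro R hR s t h ih =>
    obtain ⟨hs, hv, h⟩ := (step_iff hadm).mp h
    refine (kv'_iff hadm).mpr ⟨hs, hv.trans h'.varGe, ?_⟩
    rw [← h'.weight_eq W]
    exact h.imp_right fun h => ⟨h.1, h.2.comp_aCEq hadm (fun a b c hab hbc => ih a b hab hbc) h'⟩

theorem KV'.aCEq_comp (hadm : W.Admissible P) (h : ACEq AC s t) (h' : KV' AC P W t u) :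
    KV' AC P W s u := by
  induction h' generalizing s with
  | intro R hR t u h' ih =>
    obtain ⟨hs, hv, h'⟩ := (step_iff hadm).mp h'
    refine (kv'_iff hadm).mpr ⟨mt h.isVar_iff.mp hs, h.varGe.trans hv, ?_⟩
    rw [h.weight_eq W]
    exact h'.imp_right fun h' =>
      ⟨h'.1, h'.2.aCEq_comp hadm (fun a b c hab hbc => ih b c hbc hab) h⟩

theorem KV'.trans (hadm : W.Admissible P) (h : KV' AC P W s t) (h' : KV' AC P W t u) :
    KV' AC P W s u := by
  induction h generalizing u with
  | intro R hR s t h ih =>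
    obtain ⟨hs, hv, h⟩ := (step_iff hadm).mp h
    obtain ⟨ht, hv', h'⟩ := (kv'_iff hadm).mp h'
    refine (kv'_iff hadm).mpr ⟨hs, hv.trans hv', ?_⟩
    rcases h with h | ⟨hw, h⟩ <;> rcases h' with h' | ⟨hw', h'⟩
    · exact .inl (h'.trans h)
    · exact .inl (hw' ▸ h)
    · exact .inl (hw ▸ h')
    · exact .inr ⟨hw.trans hw', h.comp hadm
        (fun a b c hab hbc => KV'.comp_aCEq hadm (hR a b hab) hbc)
        (fun a b c hab hbc => hbc.aCEq_comp hadm hab) (fun a b c hab hbc => ih a b hab hbc) ht h'⟩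

end Trans

/-! ### Subterms, contexts and substitutions -/

section Closure

variable {L : FirstOrder.Language.{u, v}} {V : Type w} {AC : Set (L.Functions 2)}
  {P : Precedence L} {W : WeightFunction L} {s t : L.Term V}

/-- If an argument has the same weight as the whole term, then the root is the maximal unary symbol
of weight zero. It is either larger than the root of the argument or equal to it; in the latter
case, the arguments are compared. -/
theorem KV'.func_arg (hadm : W.Admissible P) {n : ℕ} (f : L.Functions n)
    (ts : Fin n → L.Term V) (i : Fin n) : KV' AC P W (.func f ts) (ts i) := by
  suffices h : ∀ (t : L.Term V) {n : ℕ} (f : L.Functions n) (ts : Fin n → L.Term V) (i : Fin n),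
      ts i = t → KV' AC P W (.func f ts) (ts i) from h _ f ts i rfl
  intro t
  induction t with
  | var x =>
    intro n f ts i hi
    refine (kv'_iff hadm).mpr ⟨not_isVar_func _ _, varGe_arg f ts i, ?_⟩
    exact (weight_arg_le W f ts i).lt_or_eq.imp_right fun hw => ⟨hw.symm, .inl ⟨x, hi⟩⟩
  | @func m g us ih =>
    intro n f ts i hi
    refine (kv'_iff hadm).mpr ⟨not_isVar_func _ _, varGe_arg f ts i, ?_⟩
    refine (weight_arg_le W f ts i).lt_or_eq.imp_right fun hw => ⟨hw.symm, ?_⟩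
    obtain ⟨rfl, hf⟩ := eq_one_of_weight_arg_eq W hw.symm
    by_cases hg : (⟨m, g⟩ : FunSym L) = ⟨1, f⟩
    · cases hg
      refine .inr (.inr (.inl ⟨1, f, ts, us, rfl, hi, fun h _ heq => (by simp at heq), 0, ?_, ?_⟩))
      · intro j hj
        exact (Fin.not_lt_zero j hj).elim
      · rw [Subsingleton.elim i 0] at hi
        rw [hi]
        exact ih 0 f us 0 rfl
    · exact .inr (.inl ⟨_, _, rfl, by rw [hi]; rfl, hadm f hf _ hg⟩)

/-- At equal weight, a decrease from `s` to `t` is visible in the top-flattenings with respect to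
any symbol `f`, that is, directly below a root symbol `f`. -/
theorem KV'.flatStep (hadm : W.Admissible P) {f : L.Functions 2} (hf : f ∈ AC) (h : KV' AC P W s t)
    (hw : weight W s = weight W t) :
    FlatStep AC P W (KV' AC P W) f (topFlat f s) (topFlat f t) := by
  classical
  obtain ⟨hs, hv, hd⟩ := (kv'_iff hadm).mp h
  replace hd := (hd.resolve_left hw.not_gt).2
  have hp := orderPair_kvGe (V := V) hadm
  by_cases hsf : root s = .inr ⟨2, f⟩ <;> by_cases htf : root t = .inr ⟨2, f⟩
  · rcases hd with hd | ⟨g, g', hg, hg', hgt⟩ | ⟨n, g, ss, ts, rfl, rfl, hg, -⟩ |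
      ⟨g, hg, hsg, -, hd⟩
    · exact (not_isVar_of_root htf hd).elim
    · cases hsf.symm.trans hg
      cases htf.symm.trans hg'
      exact (P.irrefl _ hgt).elim
    · cases hsf
      exact (hg f hf rfl).elim
    · cases hsf.symm.trans hsg
      exact hd
  · have ht : ¬ IsVar t := by
      rintro ⟨x, rfl⟩
      obtain ⟨ss, rfl⟩ := exists_func_of_root hsf
      exact (w₀_le_weight W (ss 0)).not_gt ((weight_lt_func_two f ss 0).trans_eq hw)
    have hlt : ¬ NotLt P ⟨2, f⟩ t := by
      rintro ⟨g, hg, hgt⟩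
      rcases hd.root with ⟨f', g', hf', hg', hgt'⟩ | h' | h'
      · cases hsf.symm.trans hf'
        cases hg.symm.trans hg'
        exact hgt hgt'
      · exact htf (h'.symm.trans hsf)
      · exact ht h'
    rw [topFlat_of_root_ne htf]
    refine .inr ⟨?_, .inl ?_⟩
    · rw [FlatGe, rhsPart_singleton_eq_zero hlt ht]
      exact .zero_right
    · obtain ⟨ss, rfl⟩ := exists_func_of_root hsf
      have h₀ := card_pos.mpr (topFlat_ne_zero f (ss 0))
      have h₁ := card_pos.mpr (topFlat_ne_zero f (ss 1))
      rw [topFlat_func, card_add, card_singleton]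
      omega
  · have hs' : NotLt P ⟨2, f⟩ s := by
      rcases hd.root with ⟨f', g', hf', hg', hgt'⟩ | h' | h'
      · cases htf.symm.trans hg'
        exact ⟨f', hf', fun h => P.irrefl _ (P.trans _ _ _ h hgt')⟩
      · exact (hsf (h'.trans htf)).elim
      · exact (not_isVar_of_root htf h').elim
    rw [topFlat_of_root_ne hsf]
    left
    rw [FlatGt, notLtPart_singleton_of_pos hs']
    refine .of_forall (singleton_ne_zero s) fun y hy => ⟨s, mem_singleton_self s, ?_⟩
    have hy' := Multiset.mem_of_le (rhsPart_le_right _ _ _) hy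
    exact ⟨hv.trans (varGe_and_weight_le_of_mem_topFlat (W := W) hy').1,
      .inl (hw ▸ weight_lt_of_mem_topFlat htf hy')⟩
  · rw [topFlat_of_root_ne hsf, topFlat_of_root_ne htf]
    refine .inr ⟨?_, .inr ⟨by simp, .of_forall (singleton_ne_zero s) (by simpa using h)⟩⟩
    by_cases hs' : NotLt P ⟨2, f⟩ s
    · rw [FlatGe, notLtPart_singleton_of_pos hs']
      refine hp.mulGe_trans (.of_rel (.cons ⟨hv, .inr ⟨hw, ?_⟩⟩ .zero))
        (hp.mulGe_of_le (rhsPart_le_right _ _ _))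
      exact or_assoc.mpr hd.root
    -- The root of `s` is smaller than `f`, hence not maximal, so `t` is no variable.
    · obtain ⟨g, hg⟩ := exists_root_of_not_isVar hs
      have hgf : P.gt ⟨2, f⟩ g := by
        by_contra h'
        exact hs' ⟨g, hg, h'⟩
      have ht : ¬ IsVar t := by
        rintro ⟨x, rfl⟩
        obtain ⟨g', hg', hmax⟩ := root_of_weight_eq hadm hs hv.one_le_occ hw
        cases hg.symm.trans hg'
        exact P.irrefl _ (P.trans _ _ _ hgf (hmax _ (by simp)))
      rw [FlatGe, rhsPart_singleton_eq_zero _ ht]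
      · exact .zero_right
      rintro ⟨k, hk, hkf⟩
      rcases hd.root with ⟨g', k', hg', hk', hgt⟩ | h' | h'
      · cases hg.symm.trans hg'
        cases hk.symm.trans hk'
        exact hkf (P.trans _ _ _ hgf hgt)
      · cases hk.symm.trans (h'.symm.trans hg)
        exact hkf hgf
      · exact ht h'

theorem KV'.update (hadm : W.Admissible P) {n : ℕ} (f : L.Functions n) (ts : Fin n → L.Term V)
    (i : Fin n) (h : KV' AC P W s t) :
    KV' AC P W (.func f (Function.update ts i s)) (.func f (Function.update ts i t)) := by
  refine (kv'_iff hadm).mpr ⟨not_isVar_func _ _, h.varGe.update f ts i, ?_⟩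
  have hw := weight_update_add (W := W) f ts i s t
  rcases h.weight_le.lt_or_eq with hlt | heq
  · left; omega
  refine .inr ⟨by omega, ?_⟩
  by_cases hf : ∃ g ∈ AC, (⟨n, f⟩ : FunSym L) = ⟨2, g⟩
  · obtain ⟨g, hg, hfg⟩ := hf
    cases hfg
    refine .inr (.inr (.inr ⟨_, hg, rfl, rfl, ?_⟩))
    have hstep := h.flatStep hadm hg heq.symm
    rw [topFlat_func, topFlat_func]
    fin_cases i
    · simpa using hstep.add_right hadm (K := topFlat g (ts 1))
    · simpa [add_comm] using hstep.add_right hadm (K := topFlat g (ts 0))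
  · push Not at hf
    refine .inr (.inr (.inl ⟨n, f, _, _, rfl, rfl, hf, i, fun j hj => ?_, by simpa using h⟩))
    simpa [hj.ne] using ACEq.refl _

end Closure

section Substitution

open scoped Classical

variable {L : FirstOrder.Language.{u, v}} {V : Type w} {AC : Set (L.Functions 2)}
  {P : Precedence L} {W : WeightFunction L} {f : L.Functions 2} {σ : V → L.Term V}
  {S T M N : Multiset (L.Term V)} {s t : L.Term V}

variable (f σ) in
/-- The top-flattenings of the instances of the terms in `S`. By `topFlat_subst`, this is the
top-flattening of an instance `s.subst σ` if `S` is the top-flattening of `s`. -/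
noncomputable def flatSubst (S : Multiset (L.Term V)) : Multiset (L.Term V) :=
  S.bind fun u => topFlat f (u.subst σ)

theorem flatSubst_cons (t : L.Term V) (S : Multiset (L.Term V)) :
    flatSubst f σ (t ::ₘ S) = topFlat f (t.subst σ) + flatSubst f σ S :=
  cons_bind ..

theorem flatSubst_add (S T : Multiset (L.Term V)) :
    flatSubst f σ (S + T) = flatSubst f σ S + flatSubst f σ T :=
  add_bind ..

theorem topFlat_subst_of_not_isVar (ht : ¬ IsVar t) (hf : root t ≠ .inr ⟨2, f⟩) :
    topFlat f (t.subst σ) = {t.subst σ} := by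
  obtain ⟨g, hg⟩ := exists_root_of_not_isVar ht
  exact topFlat_of_root_ne (by rwa [root_subst hg, ← hg])

theorem notLt_subst_iff (ht : ¬ IsVar t) {g : FunSym L} :
    NotLt P g (t.subst σ) ↔ NotLt P g t := by
  obtain ⟨k, hk⟩ := exists_root_of_not_isVar ht
  rw [NotLt, NotLt, root_subst hk, hk]

theorem notLtPart_flatSubst (hS : ∀ u ∈ S, root u ≠ .inr ⟨2, f⟩) :
    notLtPart P ⟨2, f⟩ (flatSubst f σ S) = (notLtPart P ⟨2, f⟩ S).map (·.subst σ) +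
      notLtPart P ⟨2, f⟩ (flatSubst f σ (varPart S)) := by
  induction S using Multiset.induction_on with
  | empty => simp [notLtPart, varPart, flatSubst]
  | cons t S ih =>
    specialize ih fun u hu => hS u (mem_cons_of_mem hu)
    by_cases ht : IsVar t
    · rw [flatSubst_cons, notLtPart_add, ih, varPart_cons_of_pos ht, flatSubst_cons,
        notLtPart_add, notLtPart_cons_of_neg fun h => h.not_isVar ht, add_left_comm]
    · rw [flatSubst_cons, notLtPart_add, ih, varPart_cons_of_neg ht,
        topFlat_subst_of_not_isVar ht (hS t (mem_cons_self t S)), ← add_assoc]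
      congr 1
      by_cases h : NotLt P ⟨2, f⟩ t
      · rw [notLtPart_cons_of_pos h, notLtPart_singleton_of_pos ((notLt_subst_iff ht).mpr h),
          map_cons, singleton_add]
      · rw [notLtPart_cons_of_neg h, notLtPart_singleton_of_neg (mt (notLt_subst_iff ht).mp h),
          zero_add]

theorem varPart_flatSubst (hS : ∀ u ∈ S, root u ≠ .inr ⟨2, f⟩) :
    varPart (flatSubst f σ S) = varPart (flatSubst f σ (varPart S)) := by
  induction S using Multiset.induction_on with
  | empty => simp [varPart, flatSubst]
  | cons t S ih =>
    specialize ih fun u hu => hS u (mem_cons_of_mem hu)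
    by_cases ht : IsVar t
    · rw [flatSubst_cons, varPart_add, ih, varPart_cons_of_pos ht, flatSubst_cons, varPart_add]
    · rw [flatSubst_cons, varPart_add, ih, varPart_cons_of_neg ht,
        topFlat_subst_of_not_isVar ht (hS t (mem_cons_self t S)),
        varPart_singleton_of_neg (not_isVar_subst ht σ), zero_add]

/-- Only the variables of a top-flattening have instances that are flattened further. -/
theorem card_flatSubst (hS : ∀ u ∈ S, root u ≠ .inr ⟨2, f⟩) :
    card (flatSubst f σ S) + card (varPart S) =
      card S + card (flatSubst f σ (varPart S)) := by
  induction S using Multiset.induction_on with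
  | empty => simp [varPart, flatSubst]
  | cons t S ih =>
    specialize ih fun u hu => hS u (mem_cons_of_mem hu)
    by_cases ht : IsVar t
    · rw [flatSubst_cons, varPart_cons_of_pos ht, flatSubst_cons]
      simp only [card_add, card_cons]
      omega
    · rw [flatSubst_cons, varPart_cons_of_neg ht,
        topFlat_subst_of_not_isVar ht (hS t (mem_cons_self t S))]
      simp only [card_add, card_cons, card_singleton]
      omega

theorem card_le_card_flatSubst (S : Multiset (L.Term V)) : card S ≤ card (flatSubst f σ S) := by
  induction S using Multiset.induction_on with
  | empty => simp
  | cons t S ih =>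
    have := card_pos.mpr (topFlat_ne_zero f (t.subst σ))
    rw [flatSubst_cons, card_add, card_cons]
    omega

theorem flatSubst_of_root_ne (h : ∀ u ∈ S, root (u.subst σ) ≠ .inr ⟨2, f⟩) :
    flatSubst f σ S = S.map (·.subst σ) := by
  rw [flatSubst, ← bind_singleton]
  exact bind_congr fun u hu => topFlat_of_root_ne (h u hu)

theorem WRootGt.of_mem_topFlat (h : WRootGt P W s t) {u : L.Term V} (hu : u ∈ topFlat f t) :
    WRootGt P W s u := by
  by_cases ht : root t = .inr ⟨2, f⟩
  · exact ⟨h.1.trans (varGe_and_weight_le_of_mem_topFlat (W := W) hu).1,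
      .inl ((weight_lt_of_mem_topFlat ht hu).trans_le h.weight_le)⟩
  · rw [topFlat_of_root_ne ht, mem_singleton] at hu
    rwa [hu]

theorem mulGt_subst_of_forall (hM : M ≠ 0) (h : ∀ y ∈ N, ∃ x ∈ M, WRootGt P W x y) :
    MulGt (KvGe P W) (WRootGt P W) (M.map (·.subst σ)) (flatSubst f σ N) := by
  refine .of_forall (by simpa using hM) fun y hy => ?_
  obtain ⟨u, hu, hy⟩ := mem_bind.mp hy
  obtain ⟨x, hx, hxu⟩ := h u hu
  exact ⟨_, mem_map_of_mem _ hx, (hxu.subst σ).of_mem_topFlat hy⟩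

/-- A term paired with `u` by `≥_{kv'}` has an instance that is above all terms of the
top-flattening of the instance of `u`, if the latter is not trivial. Hence the comparison of the
instances is strict in this case. -/
theorem mulGe_subst_of_rel (hadm : W.Admissible P) (h : Multiset.Rel (KvGe P W) M N) :
    MulGt (KvGe P W) (WRootGt P W) (M.map (·.subst σ)) (flatSubst f σ N) ∨
    (MulGe (KvGe P W) (WRootGt P W) (M.map (·.subst σ)) (flatSubst f σ N) ∧
      ∀ u ∈ N, root (u.subst σ) ≠ .inr ⟨2, f⟩) := by
  induction h with
  | zero => exact .inr ⟨by simpa [flatSubst] using MulGe.zero_right, by simp⟩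
  | @cons a b as bs hab _ ih =>
    rw [map_cons, flatSubst_cons, ← singleton_add]
    have hab' := hab.subst hadm σ
    by_cases hb : root (b.subst σ) = .inr ⟨2, f⟩
    · refine .inl (.add_mulGe (.of_forall (singleton_ne_zero _) fun y hy =>
        ⟨_, mem_singleton_self _, hab'.1.trans (varGe_and_weight_le_of_mem_topFlat (W := W) hy).1,
          .inl ((weight_lt_of_mem_topFlat hb hy).trans_le hab'.weight_le)⟩)
        (ih.elim MulGt.mulGe And.left))
    · rw [topFlat_of_root_ne hb]
      have h1 : MulGe (KvGe P W) (WRootGt P W) {a.subst σ} {b.subst σ} :=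
        .of_rel (.cons hab' .zero)
      rcases ih with ih | ⟨ih, ih'⟩
      · rw [add_comm, add_comm {b.subst σ}]
        exact .inl (ih.add_mulGe h1)
      · exact .inr ⟨h1.add ih, by simpa [hb] using ih'⟩

theorem MulGt.subst (hadm : W.Admissible P) (h : MulGt (KvGe P W) (WRootGt P W) M N) :
    MulGt (KvGe P W) (WRootGt P W) (M.map (·.subst σ)) (flatSubst f σ N) := by
  obtain ⟨M₁, M₂, N₁, N₂, rfl, rfl, h3, h4, h5⟩ := h
  rw [Multiset.map_add, flatSubst_add, add_comm, add_comm (flatSubst f σ N₁)]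
  exact (mulGt_subst_of_forall h4 h5).add_mulGe
    ((mulGe_subst_of_rel hadm h3).elim MulGt.mulGe And.left)

theorem MulGe.subst (hadm : W.Admissible P) (h : MulGe (KvGe P W) (WRootGt P W) M N) :
    MulGt (KvGe P W) (WRootGt P W) (M.map (·.subst σ)) (flatSubst f σ N) ∨
    (MulGe (KvGe P W) (WRootGt P W) (M.map (·.subst σ)) (flatSubst f σ N) ∧
      ∀ u ∈ N, root (u.subst σ) ≠ .inr ⟨2, f⟩) := by
  by_cases hgt : MulGt (KvGe P W) (WRootGt P W) M N
  · exact .inl (hgt.subst hadm)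
  obtain ⟨M₁, M₂, N₁, N₂, rfl, rfl, h3, h5⟩ := h
  obtain rfl : M₂ = 0 := by
    by_contra h4
    exact hgt ⟨M₁, M₂, N₁, N₂, rfl, rfl, h3, h4, h5⟩
  obtain rfl : N₂ = 0 := eq_zero_of_forall_notMem fun y hy => by simpa using h5 y hy
  simpa using mulGe_subst_of_rel hadm h3

/-- Instances of the variables that `S` and `T` have in common contribute equally to both sides;
only the instances of the excess variables of `T` have to be dominated. -/
theorem rhsPart_flatSubst_le (hS : ∀ u ∈ S, root u ≠ .inr ⟨2, f⟩)
    (hT : ∀ u ∈ T, root u ≠ .inr ⟨2, f⟩) :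
    rhsPart P ⟨2, f⟩ (flatSubst f σ S) (flatSubst f σ T) ≤
      flatSubst f σ (rhsPart P ⟨2, f⟩ S T) +
        notLtPart P ⟨2, f⟩ (flatSubst f σ (varPart S)) := by
  have hn : flatSubst f σ (notLtPart P ⟨2, f⟩ T) =
      (notLtPart P ⟨2, f⟩ T).map (·.subst σ) := flatSubst_of_root_ne fun u hu => by
    obtain ⟨hu, g, hg, -⟩ := mem_notLtPart.mp hu
    rw [root_subst hg, ← hg]
    exact hT u hu
  have hle : flatSubst f σ (varPart T) ≤
      flatSubst f σ (varPart S) + flatSubst f σ (varPart T - varPart S) := by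
    rw [← flatSubst_add]
    obtain ⟨K, hK⟩ := Multiset.le_iff_exists_add.mp
      (le_add_tsub : varPart T ≤ varPart S + (varPart T - varPart S))
    rw [hK, flatSubst_add]
    exact Multiset.le_add_right _ _
  have h1 : notLtPart P ⟨2, f⟩ (flatSubst f σ (varPart T)) ≤
      notLtPart P ⟨2, f⟩ (flatSubst f σ (varPart S)) +
        notLtPart P ⟨2, f⟩ (flatSubst f σ (varPart T - varPart S)) :=
    (filter_le_filter _ hle).trans_eq (notLtPart_add ..)
  have h2 : varPart (flatSubst f σ (varPart T)) - varPart (flatSubst f σ (varPart S)) ≤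
      varPart (flatSubst f σ (varPart T - varPart S)) :=
    tsub_le_iff_left.mpr ((filter_le_filter _ hle).trans_eq (varPart_add ..))
  rw [rhsPart, rhsPart, notLtPart_flatSubst hT, varPart_flatSubst hT, varPart_flatSubst hS,
    flatSubst_add, hn, add_assoc, add_assoc]
  refine add_le_add le_rfl ((add_le_add h1 h2).trans ?_)
  rw [add_assoc, add_comm]
  exact add_le_add (notLtPart_add_varPart_le ..) le_rfl

theorem FlatGt.subst (hadm : W.Admissible P) (hS : ∀ u ∈ S, root u ≠ .inr ⟨2, f⟩)
    (hT : ∀ u ∈ T, root u ≠ .inr ⟨2, f⟩) (h : FlatGt P W f S T) :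
    FlatGt P W f (flatSubst f σ S) (flatSubst f σ T) := by
  have hp := orderPair_kvGe (V := V) hadm
  rw [FlatGt, notLtPart_flatSubst hS]
  exact hp.mulGt_mulGe_trans ((MulGt.subst hadm h).add_mulGe (hp.mulGe_refl _))
    (hp.mulGe_of_le (rhsPart_flatSubst_le hS hT))

/-- If some excess variable of `T` has an instance with root `f`, then the comparison becomes strict;
otherwise the top-flattening on the left grows at least as much as the one on the right. -/
theorem FlatGe.subst (hadm : W.Admissible P) (hS : ∀ u ∈ S, root u ≠ .inr ⟨2, f⟩)
    (hT : ∀ u ∈ T, root u ≠ .inr ⟨2, f⟩) (h : FlatGe P W f S T) :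
    FlatGt P W f (flatSubst f σ S) (flatSubst f σ T) ∨
    (FlatGe P W f (flatSubst f σ S) (flatSubst f σ T) ∧
      card (flatSubst f σ T) + card S ≤ card (flatSubst f σ S) + card T) := by
  have hp := orderPair_kvGe (V := V) hadm
  rw [FlatGt, FlatGe, notLtPart_flatSubst hS]
  rcases MulGe.subst (σ := σ) (f := f) hadm h with h | ⟨h, h'⟩
  · exact .inl (hp.mulGt_mulGe_trans (h.add_mulGe (hp.mulGe_refl _))
      (hp.mulGe_of_le (rhsPart_flatSubst_le hS hT)))
  refine .inr ⟨hp.mulGe_trans (h.add (hp.mulGe_refl _))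
    (hp.mulGe_of_le (rhsPart_flatSubst_le hS hT)), ?_⟩
  have hY : card (flatSubst f σ (varPart T - varPart S)) = card (varPart T - varPart S) := by
    rw [flatSubst_of_root_ne fun u hu => h' u (mem_add.mpr (.inr hu)), card_map]
  have hX := card_le_card_flatSubst (f := f) (σ := σ) (varPart S - varPart T)
  have hcomm : varPart T + (varPart S - varPart T) = varPart S + (varPart T - varPart S) := by
    ext x
    simp only [count_add, count_sub]
    omega
  have h1 := congr_arg Multiset.card hcomm
  have h2 := congr_arg Multiset.card (congr_arg (flatSubst f σ) hcomm)
  have h3 := card_flatSubst (σ := σ) hS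
  have h4 := card_flatSubst (σ := σ) hT
  rw [flatSubst_add, flatSubst_add] at h2
  simp only [card_add] at h1 h2
  omega

theorem KV'.of_mem_topFlat (h : KV' AC P W s t) {u : L.Term V} (hu : u ∈ topFlat f t) :
    KV' AC P W s u := by
  by_cases ht : root t = .inr ⟨2, f⟩
  · exact (kvScheme_iff s u).mpr
      ⟨h.varGe.trans (varGe_and_weight_le_of_mem_topFlat (W := W) hu).1,
        .inl ((weight_lt_of_mem_topFlat ht hu).trans_le h.weight_le)⟩
  · rw [topFlat_of_root_ne ht, mem_singleton] at hu
    rwa [hu]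

theorem MulGt.flatSubst {R : L.Term V → L.Term V → Prop}
    (hR : ∀ a b, R a b → ¬ IsVar a ∧ KV' AC P W (a.subst σ) (b.subst σ))
    (hS : ∀ u ∈ S, root u ≠ .inr ⟨2, f⟩) (h : MulGt (ACEq AC) R S T) :
    MulGt (ACEq AC) (KV' AC P W) (flatSubst f σ S) (flatSubst f σ T) := by
  obtain ⟨M₁, M₂, N₁, N₂, rfl, rfl, h3, h4, h5⟩ := h
  rw [flatSubst_add, flatSubst_add]
  refine ⟨_, _, _, _, rfl, rfl, rel_bind (fun a b hab => (hab.subst σ).rel_topFlat f) h3,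
    ?_, fun y hy => ?_⟩
  · obtain ⟨m, hm⟩ := exists_mem_of_ne_zero h4
    obtain ⟨x, hx⟩ := exists_mem_of_ne_zero (topFlat_ne_zero f (m.subst σ))
    exact fun h0 => notMem_zero x (h0 ▸ mem_bind.mpr ⟨m, hm, hx⟩)
  · obtain ⟨u, hu, hy⟩ := mem_bind.mp hy
    obtain ⟨x, hx, hxu⟩ := h5 u hu
    obtain ⟨hxv, hxu⟩ := hR x u hxu
    refine ⟨x.subst σ, mem_bind.mpr ⟨x, hx, ?_⟩, hxu.of_mem_topFlat hy⟩
    rw [topFlat_subst_of_not_isVar hxv (hS x (mem_add.mpr (.inr hx)))]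
    exact mem_singleton_self _

theorem FlatStep.subst (hadm : W.Admissible P) {R : L.Term V → L.Term V → Prop}
    (hR : ∀ a b, R a b → ¬ IsVar a ∧ KV' AC P W (a.subst σ) (b.subst σ))
    (hS : ∀ u ∈ S, root u ≠ .inr ⟨2, f⟩) (hT : ∀ u ∈ T, root u ≠ .inr ⟨2, f⟩)
    (h : FlatStep AC P W R f S T) :
    FlatStep AC P W (KV' AC P W) f (flatSubst f σ S) (flatSubst f σ T) := by
  rcases h with h | ⟨hge, h⟩
  · exact .inl (h.subst hadm hS hT)
  refine (hge.subst (σ := σ) hadm hS hT).imp_right fun ⟨hge, hc⟩ => ⟨hge, ?_⟩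
  rcases h with h | ⟨h, h'⟩
  · left; omega
  · rcases (show card (ACKBO.flatSubst f σ T) ≤ card (ACKBO.flatSubst f σ S) by
      omega).lt_or_eq with h'' | h''
    · exact .inl h''
    · exact .inr ⟨h''.symm, h'.flatSubst hR hS⟩

/-- This covers the comparison of `s` with a variable: the instance of a tower over `x` may have the
same root as the instance of `x`, but contains the latter as a proper subterm. -/
theorem KV'.subst_var (hadm : W.Admissible P) (σ : V → L.Term V) {x : V} (hs : ¬ IsVar s)
    (hx : 1 ≤ occ x s) : KV' AC P W (s.subst σ) (σ x) := by
  induction s with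
  | var y => exact (hs ⟨y, rfl⟩).elim
  | @func n g ts ih =>
    obtain ⟨i, hi⟩ : ∃ i, 1 ≤ occ x (ts i) := by
      by_contra! h
      rw [occ, Finset.sum_eq_zero fun i _ => by simpa using h i] at hx
      omega
    have harg : KV' AC P W (Term.func g fun i => (ts i).subst σ) ((ts i).subst σ) :=
      KV'.func_arg hadm g (fun i => (ts i).subst σ) i
    by_cases hv : IsVar (ts i)
    · obtain ⟨y, hy⟩ := hv
      obtain rfl : y = x := by
        by_contra h
        simp [hy, occ, h] at hi
      rwa [hy] at harg
    · exact harg.trans hadm (ih i hv hi)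

theorem KV'.subst (hadm : W.Admissible P) (σ : V → L.Term V) (h : KV' AC P W s t) :
    KV' AC P W (s.subst σ) (t.subst σ) := by
  induction h with
  | intro R hR s t h ih =>
    obtain ⟨hs, hv, h⟩ := (step_iff hadm).mp h
    by_cases ht : IsVar t
    · obtain ⟨x, rfl⟩ := ht
      exact KV'.subst_var hadm σ hs hv.one_le_occ
    have hw := hv.weight_subst (W := W) σ
    refine (kv'_iff hadm).mpr ⟨not_isVar_subst hs σ, hv.subst σ, ?_⟩
    rcases h with h | ⟨hst, h⟩
    · left; omega
    rcases (show weight W (t.subst σ) ≤ weight W (s.subst σ) by omega).lt_or_eq with hlt | heq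
    · exact .inl hlt
    refine .inr ⟨heq.symm, ?_⟩
    rcases h with h | h | ⟨n, f, ss, ts, rfl, rfl, hf, k, hk, hk'⟩ | ⟨f, hf, hs', ht', h⟩
    · exact (ht h).elim
    · exact .inr (.inl (h.subst σ))
    · exact .inr (.inr (.inl ⟨n, f, _, _, rfl, rfl, hf, k, fun i hi => (hk i hi).subst σ,
        ih _ _ hk'⟩))
    · refine .inr (.inr (.inr ⟨f, hf, root_subst hs' σ, root_subst ht' σ, ?_⟩))
      rw [topFlat_subst, topFlat_subst]
      exact h.subst hadm (fun a b hab => ⟨KV'.not_isVar (hR a b hab), ih a b hab⟩)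
        (fun _ => root_ne_of_mem_topFlat) fun _ => root_ne_of_mem_topFlat

end Substitution

/-! ### Well-foundedness -/

section AccRank

variable {A : Type*} {r : A → A → Prop} {a b : A}

open Classical in
/-- The rank of an accessible element, and `0` for other elements. -/
noncomputable def accRank (r : A → A → Prop) (a : A) : Ordinal :=
  if h : Acc r a then h.rank else 0

theorem accRank_lt (hb : Acc r b) (h : r a b) : accRank r a < accRank r b := by
  rw [accRank, accRank, dif_pos hb, dif_pos (hb.inv h)]
  exact hb.rank_lt_of_rel h

theorem accRank_le (ha : Acc r a) (h : ∀ c, r c b → r c a) : accRank r b ≤ accRank r a := by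
  have hb : Acc r b := ⟨b, fun c hc => ha.inv (h c hc)⟩
  rw [accRank, accRank, dif_pos hb, dif_pos ha, hb.rank_eq]
  exact Ordinal.iSup_le fun c => Order.succ_le_of_lt (ha.rank_lt_of_rel (h c c.2))

theorem accRank_eq (h : ∀ c, r c a ↔ r c b) : accRank r a = accRank r b := by
  by_cases ha : Acc r a
  · have hb : Acc r b := ⟨b, fun c hc => ha.inv ((h c).mpr hc)⟩
    exact le_antisymm (accRank_le hb fun c => (h c).mp) (accRank_le ha fun c => (h c).mpr)
  · have hb : ¬ Acc r b := fun hb => ha ⟨a, fun c hc => hb.inv ((h c).mp hc)⟩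
    rw [accRank, accRank, dif_neg ha, dif_neg hb]

end AccRank

section WellFounded

variable {L : FirstOrder.Language.{u, v}} {V : Type w} {AC : Set (L.Functions 2)}
  {P : Precedence L} {W : WeightFunction L} {s t : L.Term V}

variable (AC P W) in
/-- The converse of `>_KV'`. -/
def KV'Lt (t s : L.Term V) : Prop := KV' AC P W s t

variable (AC P W) in
/-- All arguments of `s` are accessible. -/
def ArgsAcc (s : L.Term V) : Prop :=
  ∀ (n : ℕ) (f : L.Functions n) (ts : Fin n → L.Term V), s = .func f ts →
    ∀ i, Acc (KV'Lt AC P W) (ts i)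

/-- It suffices to consider smaller terms with accessible arguments: by the subterm property and
transitivity, the arguments of a term below `s` are themselves below `s`. -/
theorem acc_of_forall_argsAcc (hadm : W.Admissible P)
    (h : ∀ t, KV' AC P W s t → ArgsAcc AC P W t → Acc (KV'Lt AC P W) t) :
    Acc (KV'Lt AC P W) s := by
  refine ⟨s, fun t ht => ?_⟩
  change KV' AC P W s t at ht
  induction t with
  | var x => exact h _ ht (by rintro n f ts ⟨⟩)
  | func f ts ih =>
    refine h _ ht ?_
    rintro n g us hg i
    cases hg
    exact ih i (ht.trans hadm (KV'.func_arg hadm f ts i))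

theorem acc_of_isVar (h : IsVar s) : Acc (KV'Lt AC P W) s :=
  ⟨s, fun _ ht => (KV'.not_isVar ht h).elim⟩

theorem acc_of_mem_topFlat (hadm : W.Admissible P) {f : L.Functions 2} {u : L.Term V}
    (h : Acc (KV'Lt AC P W) t) (hu : u ∈ topFlat f t) : Acc (KV'Lt AC P W) u := by
  induction t using topFlat_induction f with
  | flat t ht => rw [topFlat_of_root_ne ht, mem_singleton] at hu; rwa [hu]
  | func ts h₀ h₁ =>
    rw [topFlat_func, mem_add] at hu
    exact hu.elim (h₀ (h.inv (KV'.func_arg hadm f ts 0))) (h₁ (h.inv (KV'.func_arg hadm f ts 1)))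

theorem accRank_eq_of_aCEq (hadm : W.Admissible P) (h : ACEq AC s t) :
    accRank (KV'Lt AC P W) s = accRank (KV'Lt AC P W) t :=
  accRank_eq fun _ => ⟨KV'.aCEq_comp hadm h.symm, KV'.aCEq_comp hadm h⟩

theorem accRank_le_of_kvGe [Finite (FunSym L)] (hadm : W.Admissible P) (h : KvGe P W s t) :
    accRank (fun t s => WRootGt P W s t) t ≤ accRank (fun t s => WRootGt P W s t) s :=
  accRank_le (wf_wRootGt.apply s) fun u hu => (orderPair_kvGe hadm).ge_gt s t u h hu

variable (AC P W) in
/-- The measure that decreases in a comparison of terms with AC root symbol `f`. -/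
noncomputable def flatMeasure (f : L.Functions 2) (s : L.Term V) :
    Multiset Ordinal × ℕ × Multiset Ordinal :=
  ((notLtPart P ⟨2, f⟩ (topFlat f s)).map (accRank fun t s => WRootGt P W s t),
    (topFlat f s).card, (topFlat f s).map (accRank (KV'Lt AC P W)))

theorem flatMeasure_lt [Finite (FunSym L)] (hadm : W.Admissible P) {f : L.Functions 2}
    (hs : ∀ u ∈ topFlat f s, Acc (KV'Lt AC P W) u)
    (h : FlatStep AC P W (KV' AC P W) f (topFlat f s) (topFlat f t)) :
    Prod.Lex IsDershowitzMannaLT (Prod.Lex (· < ·) IsDershowitzMannaLT)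
      (flatMeasure AC P W f t) (flatMeasure AC P W f s) := by
  rw [Prod.lex_def]
  rcases h with h | ⟨hge, h⟩
  · exact .inl ((h.mulGt_notLtPart hadm).isDershowitzMannaLT
      (fun a b => accRank_le_of_kvGe hadm) fun a _ b hab => accRank_lt (wf_wRootGt.apply a) hab)
  refine ((hge.mulGe_notLtPart hadm).eq_or_isDershowitzMannaLT
    (ρ := accRank fun t s => WRootGt P W s t) (fun a b => accRank_le_of_kvGe hadm)
    fun a _ b hab => accRank_lt (wf_wRootGt.apply a) hab).symm.imp_right fun heq => ⟨heq, ?_⟩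
  rw [Prod.lex_def]
  exact h.imp_right fun h => ⟨h.1.symm, h.2.isDershowitzMannaLT
    (fun a b hab => (accRank_eq_of_aCEq hadm hab).ge) fun a ha b hab => accRank_lt (hs a ha) hab⟩

/-- A term with accessible arguments is accessible, by lexicographic induction on its weight, its
root, and the comparison of its arguments or of its top-flattening. -/
theorem acc_of_argsAcc [Finite (FunSym L)] (hadm : W.Admissible P) (s : L.Term V)
    (hs : ArgsAcc AC P W s) : Acc (KV'Lt AC P W) s := by
  suffices h : ∀ (n : ℕ) (s : L.Term V), weight W s = n → ArgsAcc AC P W s →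
      Acc (KV'Lt AC P W) s from h _ s rfl hs
  clear hs s
  intro n
  induction n using Nat.strong_induction_on with
  | _ n ihw =>
  suffices h : ∀ (f : FunSym L) (s : L.Term V), root s = .inr f → weight W s = n →
      ArgsAcc AC P W s → Acc (KV'Lt AC P W) s by
    intro s hw hs
    by_cases hv : IsVar s
    · exact acc_of_isVar hv
    · obtain ⟨f, hf⟩ := exists_root_of_not_isVar hv
      exact h f s hf hw hs
  intro f
  induction f using (wf_precedence P).induction with
  | _ f ihr =>
  -- What remains is the comparison of two terms with the same root and weight.
  have key : ∀ s : L.Term V, root s = .inr f → weight W s = n →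
      (∀ t, root t = .inr f → weight W t = n → ArgsAcc AC P W t →
        Decrease AC P W (KV' AC P W) s t → ¬ RootGt P s t → Acc (KV'Lt AC P W) t) →
      Acc (KV'Lt AC P W) s := by
    intro s hr hw h
    refine acc_of_forall_argsAcc hadm fun t hst ht => ?_
    obtain ⟨-, -, hd⟩ := (kv'_iff hadm).mp hst
    rcases hd with hd | ⟨hwt, hd⟩
    · exact ihw _ (hw ▸ hd) t rfl ht
    by_cases hgt : RootGt P s t
    · obtain ⟨f', g, hf', hg, hfg⟩ := hgt
      cases hr.symm.trans hf'
      exact ihr g hfg t hg (hwt.symm.trans hw) ht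
    rcases hd.root with h' | h' | h'
    · exact (hgt h').elim
    · exact h t (h'.symm.trans hr) (hwt.symm.trans hw) ht hd hgt
    · exact acc_of_isVar h'
  obtain ⟨m, f⟩ := f
  by_cases hf : ∃ g ∈ AC, (⟨m, f⟩ : FunSym L) = ⟨2, g⟩
  · obtain ⟨g, hg, hfg⟩ := hf
    cases hfg
    have wf : WellFounded (Prod.Lex (IsDershowitzMannaLT (α := Ordinal.{max u w}))
        (Prod.Lex ((· < ·) : ℕ → ℕ → Prop) (IsDershowitzMannaLT (α := Ordinal.{max u w})))) :=
      WellFounded.prod_lex wellFounded_isDershowitzMannaLT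
        (WellFounded.prod_lex wellFounded_lt wellFounded_isDershowitzMannaLT)
    intro s
    induction s using (InvImage.wf (flatMeasure AC P W g) wf).induction with
    | _ s ih =>
    intro hr hw hs
    refine key s hr hw fun t hrt hwt ht hd hgt => ih t ?_ hrt hwt ht
    refine flatMeasure_lt hadm ?_ ?_
    · obtain ⟨ss, rfl⟩ := exists_func_of_root hr
      intro u hu
      rw [topFlat_func, mem_add] at hu
      exact hu.elim (acc_of_mem_topFlat hadm (hs _ _ _ rfl 0))
        (acc_of_mem_topFlat hadm (hs _ _ _ rfl 1))
    · rcases hd with h | h | ⟨m, g, ss, ts, rfl, rfl, hg', h⟩ | ⟨g, hg, hs', ht', h⟩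
      · exact (not_isVar_of_root hrt h).elim
      · exact (hgt h).elim
      · cases hr
        exact (hg' _ hg rfl).elim
      · cases hr.symm.trans hs'
        exact h
  · push Not at hf
    have wf : WellFounded (Pi.Lex (ι := Fin m) (β := fun _ => Ordinal.{max u w}) (· < ·)
        (fun {_} => (· < ·))) := Pi.Lex.wellFounded _ fun _ => wellFounded_lt
    intro s hr
    obtain ⟨ss, rfl⟩ := exists_func_of_root hr
    clear hr
    have wf' := InvImage.wf (fun (ss : Fin m → L.Term V) i => accRank (KV'Lt AC P W) (ss i)) wf
    induction ss using wf'.induction with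
    | _ ss ih =>
    intro hw hs
    refine key _ rfl hw fun t hrt hwt ht hd hgt => ?_
    rcases hd with h | h | ⟨m, g, ss, ts, hss, rfl, -, k, hk, hk'⟩ | ⟨g, hg, hs', -⟩
    · exact (not_isVar_of_root hrt h).elim
    · exact (hgt h).elim
    · cases hss
      exact ih ts ⟨k, fun j hj => (accRank_eq_of_aCEq hadm (hk j hj)).symm,
        accRank_lt (hs _ _ _ rfl k) hk'⟩ hwt ht
    · exact (hf g hg (Sum.inr_injective hs')).elim

theorem wf_kv' [Finite (FunSym L)] (hadm : W.Admissible P) :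
    WellFounded (KV'Lt AC P W : L.Term V → L.Term V → Prop) := by
  refine ⟨fun s => ?_⟩
  induction s with
  | var x => exact acc_of_isVar ⟨x, rfl⟩
  | func f ts ih =>
    refine acc_of_argsAcc hadm _ ?_
    rintro n g us hg i
    cases hg
    exact ih i

end WellFounded

/-! ### Consequences for `>_KV` -/

section Main

variable {L : FirstOrder.Language.{u, v}} {V : Type w} {AC : Set (L.Functions 2)}
  {P : Precedence L} {W : WeightFunction L} {s t : L.Term V}

theorem isACCompatibleSimplificationOrder_kv' [Finite (FunSym L)] (hadm : W.Admissible P) :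
    IsACCompatibleSimplificationOrder AC (KV' AC P W : L.Term V → L.Term V → Prop) where
  irrefl s h := (wf_kv' (AC := AC) (P := P) (V := V) hadm).irrefl.irrefl s h
  trans _ _ _ h h' := h.trans hadm h'
  contexts _ f ts i _ _ h := h.update hadm f ts i
  substitutions σ _ _ h := h.subst hadm σ
  subterm _ f ts i := KV'.func_arg hadm f ts i
  ac_compatible _ _ _ _ h h' h'' := (h'.aCEq_comp hadm h).comp_aCEq hadm h''

theorem mulGe_mono_left {A : Type*} {ge ge' gt : A → A → Prop} {M N : Multiset A}
    (hge : ∀ a b, ge a b → ge' a b) (h : MulGe ge gt M N) : MulGe ge' gt M N := by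
  obtain ⟨M₁, M₂, N₁, N₂, h1, h2, h3, h4⟩ := h
  exact ⟨M₁, M₂, N₁, N₂, h1, h2, h3.mono fun a _ b _ => hge a b, h4⟩

theorem mulGt_mono_left {A : Type*} {ge ge' gt : A → A → Prop} {M N : Multiset A}
    (hge : ∀ a b, ge a b → ge' a b) (h : MulGt ge gt M N) : MulGt ge' gt M N := by
  obtain ⟨M₁, M₂, N₁, N₂, h1, h2, h3, h4⟩ := h
  exact ⟨M₁, M₂, N₁, N₂, h1, h2, h3.mono fun a _ b _ => hge a b, h4⟩

theorem Alternative.mono_left {ge ge' R : L.Term V → L.Term V → Prop}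
    (hge : ∀ a b, ge a b → ge' a b) (h : Alternative AC P W ge R s t) :
    Alternative AC P W ge' R s t := by
  cases h with
  | case0 f x k hk => exact .case0 f x k hk
  | case1 f g ss ts hfg => exact .case1 f g ss ts hfg
  | case2 f ss ts hf hlex => exact .case2 f ss ts hf hlex
  | case3a f hf ss ts h => exact .case3a f hf ss ts (mulGt_mono_left hge h)
  | case3b f hf ss ts h hcard => exact .case3b f hf ss ts (mulGe_mono_left hge h) hcard
  | case3c f hf ss ts h hcard hmul => exact .case3c f hf ss ts (mulGe_mono_left hge h) hcard hmul

theorem KV.kv' (h : KV AC P W s t) : KV' AC P W s t := by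
  induction h with
  | intro R hR s t h ih =>
    exact .intro R ih s t ⟨h.1, h.2.imp_right fun h =>
      ⟨h.1, h.2.mono_left fun _ _ => WRootEq.kvGe⟩⟩

theorem kv'_of_rewrites (hadm : W.Admissible P) {R : Set (L.Term V × L.Term V)}
    (hR : ∀ l r : L.Term V, (l, r) ∈ R → KV AC P W l r) (h : Rewrites R s t) :
    KV' AC P W s t := by
  induction h with
  | rule l r h σ => exact (hR l r h).kv'.subst hadm σ
  | context f ts i s t _ ih => exact ih.update hadm f ts i

theorem acTerminating_of_kv [Finite (FunSym L)] (hadm : W.Admissible P)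
    {R : Set (L.Term V × L.Term V)} (hR : ∀ l r : L.Term V, (l, r) ∈ R → KV AC P W l r) :
    ACTerminating AC R := by
  refine Subrelation.wf ?_ (wf_kv' (AC := AC) (P := P) (V := V) hadm)
  rintro t s ⟨s', t', hs, hst, ht⟩
  exact ((kv'_of_rewrites hadm hR hst).aCEq_comp hadm hs).comp_aCEq hadm ht

/-- For an AC symbol `h` and a unary symbol `f` of weight zero, `f(x) >_KV x` holds, but not
`h(f(x), x) >_KV h(x, x)`: the top-flattening `{x, x}` has one excess variable `x`, which is
neither `=_{w,root}` nor `<_{w,root}` to `f(x)`. -/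
theorem not_closedUnderContexts_kv (f : L.Functions 1) (hf : W.w ⟨1, f⟩ = 0)
    {h : L.Functions 2} (hh : h ∈ AC) (x : V) :
    ¬ ClosedUnderContexts (KV AC P W : L.Term V → L.Term V → Prop) := by
  classical
  intro hc
  set s : L.Term V := .func f ![.var x] with hs
  have hws : weight W s = W.w₀ := by simp [hs, weight, hf]
  have hst : KV AC P W s (.var x) := by
    refine (kvScheme_iff _ _).mpr ⟨varGe_arg f ![.var x] 0, .inr ⟨hws, ?_⟩⟩
    exact .case0 f x 1 one_pos
  have hkv := hc 2 h (fun _ => .var x) 0 s (.var x) hst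
  rw [Function.update_eq_self] at hkv
  set ss : Fin 2 → L.Term V := Function.update (fun _ => .var x) 0 s
  have hvar : IsVar (.var x : L.Term V) := ⟨x, rfl⟩
  have hx₁ : topFlat h (.var x : L.Term V) = {.var x} := topFlat_of_root_ne (by simp [root])
  have hS : topFlat h (.func h ss) = s ::ₘ {.var x} := by
    have hs₁ : topFlat h s = {s} := topFlat_of_root_ne (by simp [hs, root])
    simp [topFlat_func, ss, hx₁, hs₁]
  have hT : topFlat h (.func h fun _ => .var x) = (.var x ::ₘ {.var x} : Multiset (L.Term V)) := by
    simp [topFlat_func, hx₁]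
  have hx : (.var x : L.Term V) ∈ rhsPart P ⟨2, h⟩ (topFlat h (.func h ss))
      (topFlat h (.func h fun _ => .var x)) := by
    have hv₁ : varPart ({.var x} : Multiset (L.Term V)) = {.var x} := varPart_cons_of_pos hvar 0
    rw [hS, hT, rhsPart, mem_add, varPart_cons_of_neg (not_isVar_func _ _),
      varPart_cons_of_pos hvar, hv₁, sub_singleton, erase_cons_head]
    exact .inr (mem_singleton_self _)
  have hno : ∀ u ∈ notLtPart P ⟨2, h⟩ (topFlat h (.func h ss)),
      ¬ WRootEq W u (.var x) ∧ ¬ WRootGt P W u (.var x) := by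
    intro u hu
    obtain ⟨hu, hu'⟩ := mem_notLtPart.mp hu
    obtain rfl : u = s := by
      rw [hS] at hu
      rcases mem_cons.mp hu with hu | hu
      · exact hu
      · exact (hu'.not_isVar (by rw [mem_singleton.mp hu]; exact hvar)).elim
    refine ⟨fun h => by simpa [root, hs] using h.2.2, fun h => ?_⟩
    rcases h.2 with h | h
    · exact h.ne' hws
    · exact h.2.not_isVar_right hvar
  have hge : ¬ MulGe (WRootEq W) (WRootGt P W) (notLtPart P ⟨2, h⟩ (topFlat h (.func h ss)))
      (rhsPart P ⟨2, h⟩ (topFlat h (.func h ss)) (topFlat h (.func h fun _ => .var x))) := by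
    rintro ⟨M₁, M₂, N₁, N₂, hM, hN, hr, hd⟩
    rw [hN, mem_add] at hx
    rw [hM] at hno
    rcases hx with hx | hx
    · obtain ⟨u, hu, hux⟩ := exists_mem_of_rel_of_mem (rel_flip.mpr hr) hx
      exact (hno u (mem_add.mpr (.inl hu))).1 hux
    · obtain ⟨u, hu, hux⟩ := hd _ hx
      exact (hno u (mem_add.mpr (.inr hu))).2 hux
  have hstep := ((kvScheme_iff _ _).mp hkv).2.resolve_left (by simp [weight, ss, hws, two_mul])
  have halt := hstep.2
  generalize hs' : Term.func h ss = s', ht' : (Term.func h fun _ => Term.var x) = t' at halt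
  cases halt with
  | case0 f x k hk => cases ht'
  | case1 f g ss ts hfg =>
    cases hs'
    cases ht'
    exact P.irrefl _ hfg
  | case2 g ss ts hg hlex =>
    cases hs'
    exact hg _ hh rfl
  | case3a g hg ss ts h3 =>
    cases hs'
    cases ht'
    exact hge h3.mulGe
  | case3b g hg ss ts h3 =>
    cases hs'
    cases ht'
    exact hge h3
  | case3c g hg ss ts h3 =>
    cases hs'
    cases ht'
    exact hge h3

end Main

end ACKBO

theorem mainTheorem2 {L : FirstOrder.Language.{u, v}} [Finite (FunSym L)] {V : Type w}
    (AC : Set (L.Functions 2)) (P : Precedence L) (W : WeightFunction L)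
    (hadm : W.Admissible P) :
    IsACCompatibleSimplificationOrder AC (KV' AC P W : L.Term V → L.Term V → Prop) ∧
    (∀ s t : L.Term V, KV AC P W s t → KV' AC P W s t) ∧
    (∀ R : Set (L.Term V × L.Term V),
      (∀ l r : L.Term V, (l, r) ∈ R → KV AC P W l r) → ACTerminating AC R) ∧
    (∀ f : L.Functions 1, W.w ⟨1, f⟩ = 0 → AC.Nonempty → Nonempty V →
      ¬ ClosedUnderContexts (KV AC P W : L.Term V → L.Term V → Prop)) :=
  ⟨isACCompatibleSimplificationOrder_kv' hadm, fun _ _ => KV.kv',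
    fun _ => acTerminating_of_kv hadm,
    fun f hf ⟨_, hh⟩ ⟨x⟩ => not_closedUnderContexts_kv f hf hh x⟩
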